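/- Work over a field $\Bbbk$ of characteristic $0$. **Long w-knots.** A Gauss diagram is a long oriented line with finitely many signed arrows whose ends are distinct points of the line (an arrow stands for a real crossing, runs from its upper to its lower strand, and carries its sign; virtual crossings are not recorded). Long w-knots are Gauss diagrams modulo the moves R$1^s$ (an isolated arrow pointing right is replaced by an isolated arrow of the same sign pointing left), R2, R3 (all orientations and signs) and OC (adjacent tails commute). **Finite type invariants.** An invariant of long w-knots with values in an Abelian group is extended to long w-knots with semi-virtual crossings by (positive semi-virtual) $=$ (positive crossing) $-$ (virtual crossing) and (negative semi-virtual) $=$ (virtual crossing) $-$ (negative crossing). It is of type $m$ if it vanishes whenever there are more than $m$ semi-virtual crossings. The underlying arrow diagram of a long w-knot diagram with semi-virtual crossings has one unsigned arrow for every semi-virtual crossing, and all other crossings are dropped. **Target.** Let $\mathcal A^{sw}(\uparrow)$ be the $\Bbbk$-vector space of formal linear combinations of arrow diagrams (long lines with finitely many unsigned arrows) modulo the relations 6T, i.e. $[a_{ij},a_{ik}]+[a_{ij},a_{jk}]+[a_{ik},a_{jk}]=0$ on three strands placed along the line in any order, RI (an isolated arrow pointing right equals an isolated arrow pointing left) and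 TC (adjacent tails commute). It is graded by the number of arrows. **Theorem.** There is a map $Z$ from long w-knots to the graded completion of $\mathcal A^{sw}(\uparrow)$ such that: 1. for every Gauss diagram $G$ of a long w-knot $K$, $Z(K)$ is obtained from $G$ by replacing each positive arrow $a$ by an exponential reservoir $e^{a}=\sum_n a^n/n!$ and each negative arrow by $e^{-a}$, where $a^n$ denotes $n$ parallel arrows (so this expression is invariant under the moves); 2. $Z$ is an expansion (a universal finite type invariant): if $K$ is a long w-knot with $m$ semi-virtual crossings and underlying arrow diagram $D$, then the extension of $Z$ satisfies $Z(K)=D+(\text{terms of degree}>m)$; 3. hence every weight system integrates: for every $m$ and every linear functional $W$ on $\mathcal A^{sw}(\uparrow)$, the invariant $V$ that takes $K$ to the value of $W$ on the degree $m$ part of $Z(K)$ is of type $m$, and $V(K)=W(D)$ for every long w-knot $K$ with exactly $m$ semi-virtual crossings and underlying arrow diagram $D$. -/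

import Mathlib

namespace WKnot

/-- The two ends of an arrow: an arrow runs from its tail to its head. -/
inductive ArrowEnd
  | tail
  | head
  deriving DecidableEq

/-- A letter `(i, e)` records that the end `e` of the arrow named `i` sits on the skeleton. -/
abbrev Letter := ℕ × ArrowEnd

/-- A long line with finitely many arrows along it whose arrows are named by natural numbers: the
word lists the arrow ends in the order in which they occur on the skeleton. -/
structure ArrowWord where
  word : List Letter
  nodup : word.Nodup
  matched : ∀ i, (i, ArrowEnd.tail) ∈ word ↔ (i, ArrowEnd.head) ∈ word

/-- The set of (names of) arrows. -/
def ArrowWord.arrows (D : ArrowWord) : Finset ℕ := (D.word.map Prod.fst).toFinset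

/-- Delete the arrows in `T`. -/
def ArrowWord.erase (D : ArrowWord) (T : Finset ℕ) : ArrowWord where
  word := D.word.filter (fun l => l.1 ∉ T)
  nodup := D.nodup.filter _
  matched i := by simp [D.matched i]

/-- Replace every arrow `i` by `n i` parallel arrows, named `Nat.pair i 0`, `Nat.pair i 1`, … . -/
def ArrowWord.cable (D : ArrowWord) (n : ℕ → ℕ) : ArrowWord where
  word := D.word.flatMap fun l => (List.range (n l.1)).map fun j => (Nat.pair l.1 j, l.2)
  nodup := by
    rw [List.nodup_flatMap]
    refine ⟨fun l _ => ?_, D.nodup.imp ?_⟩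
    · exact (List.nodup_range).map fun a b h => by simpa using h
    · intro a b hab x hx hy
      simp only [List.mem_map] at hx hy
      obtain ⟨j, -, rfl⟩ := hx
      obtain ⟨k, -, h⟩ := hy
      simp only [Prod.mk.injEq, Nat.pair_eq_pair] at h
      exact hab (Prod.ext h.1.1.symm h.2.symm)
  matched i := by
    have h := D.matched
    simp only [List.mem_flatMap, List.mem_map, List.mem_range, Prod.exists, Prod.mk.injEq]
    constructor
    · rintro ⟨a, e, hm, j, hj, rfl, rfl⟩
      exact ⟨a, _, (h a).1 hm, j, hj, rfl, rfl⟩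
    · rintro ⟨a, e, hm, j, hj, rfl, rfl⟩
      exact ⟨a, _, (h a).2 hm, j, hj, rfl, rfl⟩

/-- The word obtained from `w` by renaming arrows. -/
def rename (f : Equiv.Perm ℕ) (w : List Letter) : List Letter := w.map fun l => (f l.1, l.2)

theorem rename_rename (f g : Equiv.Perm ℕ) (w : List Letter) :
    rename g (rename f w) = rename (g * f) w := by
  simp [rename, Function.comp_def]

theorem rename_one (w : List Letter) : rename 1 w = w := by
  simp [rename]

/-- Two arrow words are the same arrow diagram if they differ by the names of the arrows. -/
instance ArrowWord.setoid : Setoid ArrowWord where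
  r D D' := ∃ f : Equiv.Perm ℕ, D'.word = rename f D.word
  iseqv :=
    { refl := fun D => ⟨1, (rename_one _).symm⟩
      symm := fun {D D'} ⟨f, h⟩ =>
        ⟨f⁻¹, by rw [h, rename_rename, inv_mul_cancel, rename_one]⟩
      trans := fun {D D' D''} ⟨f, h⟩ ⟨g, h'⟩ => ⟨g * f, by rw [h', h, rename_rename]⟩ }

/-- Arrow diagrams on a long line. -/
def ArrowDiagram : Type := Quotient ArrowWord.setoid

/-! ### Gauss diagrams and long w-knots -/

/-- A Gauss diagram of a long knot: a long line with signed arrows, each arrow running from the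
upper strand to the lower strand of its crossing (values of `sign` off the arrows are irrelevant;
virtual crossings leave no trace). -/
structure GaussDiagram extends ArrowWord where
  sign : ℕ → ℤˣ

/-- Delete the arrows in `T`, i.e. make the crossings in `T` virtual. -/
def GaussDiagram.erase (G : GaussDiagram) (T : Finset ℕ) : GaussDiagram where
  toArrowWord := G.toArrowWord.erase T
  sign := G.sign

/-- Three strands, with contents `c 0`, `c 1`, `c 2`, placed along the long line in the order
`π 0, π 1, π 2`, the rest of the line being `u`. -/
def place (u : Fin 4 → List Letter) (π : Equiv.Perm (Fin 3)) (c : Fin 3 → List Letter) :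
    List Letter :=
  u 0 ++ c (π 0) ++ u 1 ++ c (π 1) ++ u 2 ++ c (π 2) ++ u 3

/-- `x` before `y` if `ε = 1`, and `y` before `x` if `ε = -1`. -/
def inOrder (ε : ℤˣ) (x y : Letter) : List Letter := if ε = 1 then [x, y] else [y, x]

/-- One side of a third Reidemeister move, on the top, middle and bottom strands `0`, `1`, `2`.
The crossings are `x` (top over middle), `y` (top over bottom) and `z` (middle over bottom), of
signs `εx`, `εy`, `εz`. The orders are those of a triangle cut out by three oriented lines in the
plane; the eight choices of signs give the eight oriented third Reidemeister moves. -/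
def r3Side (x y z : ℕ) (εx εy εz : ℤˣ) : Fin 3 → List Letter :=
  ![inOrder εz (x, .tail) (y, .tail),
    inOrder εy (x, .head) (z, .tail),
    inOrder εx (y, .head) (z, .head)]

/-- The moves between Gauss diagrams that define long w-knots. The virtual moves VR1, VR2, VR3 and
the mixed move do not change Gauss diagrams. -/
inductive WMove : GaussDiagram → GaussDiagram → Prop
  /-- Renaming the arrows. -/
  | relabel (G G' : GaussDiagram) (f : Equiv.Perm ℕ) (hw : G'.word = rename f G.word)
      (hs : ∀ i ∈ G.arrows, G'.sign (f i) = G.sign i) : WMove G G'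
  /-- The spun first Reidemeister move: an over-then-under kink is replaced by the under-then-over
  kink of the same sign. -/
  | r1s (G G' : GaussDiagram) (hs : G'.sign = G.sign) (u v : List Letter) (i : ℕ)
      (hG : G.word = u ++ [(i, .tail), (i, .head)] ++ v)
      (hG' : G'.word = u ++ [(i, .head), (i, .tail)] ++ v) : WMove G G'
  /-- The second Reidemeister move, for parallel strands (`h = [i, j]`) or antiparallel strands
  (`h = [j, i]`), the upper strand coming first on the long line. -/
  | r2 (G G' : GaussDiagram) (hs : G'.sign = G.sign) (u v w h : List Letter) (i j : ℕ)
      (hij : G.sign j = -G.sign i)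
      (hh : h = [(i, .head), (j, .head)] ∨ h = [(j, .head), (i, .head)])
      (hG : G.word = u ++ [(i, .tail), (j, .tail)] ++ v ++ h ++ w)
      (hG' : G'.word = u ++ v ++ w) : WMove G G'
  /-- The second Reidemeister move, the lower strand coming first on the long line. -/
  | r2' (G G' : GaussDiagram) (hs : G'.sign = G.sign) (u v w h : List Letter) (i j : ℕ)
      (hij : G.sign j = -G.sign i)
      (hh : h = [(i, .head), (j, .head)] ∨ h = [(j, .head), (i, .head)])
      (hG : G.word = u ++ h ++ v ++ [(i, .tail), (j, .tail)] ++ w)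
      (hG' : G'.word = u ++ v ++ w) : WMove G G'
  /-- The third Reidemeister move. -/
  | r3 (G G' : GaussDiagram) (hs : G'.sign = G.sign) (u : Fin 4 → List Letter)
      (π : Equiv.Perm (Fin 3)) (x y z : ℕ)
      (hG : G.word = place u π (r3Side x y z (G.sign x) (G.sign y) (G.sign z)))
      (hG' : G'.word =
        place u π fun s => (r3Side x y z (G.sign x) (G.sign y) (G.sign z) s).reverse) :
      WMove G G'
  /-- Overcrossings commute. -/
  | oc (G G' : GaussDiagram) (hs : G'.sign = G.sign) (u v : List Letter) (i j : ℕ)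
      (hG : G.word = u ++ [(i, .tail), (j, .tail)] ++ v)
      (hG' : G'.word = u ++ [(j, .tail), (i, .tail)] ++ v) : WMove G G'

/-- Long w-knots: Gauss diagrams modulo the equivalence relation generated by the moves. -/
def LongWKnot : Type := Quot WMove

/-- The long w-knot of a Gauss diagram. -/
def GaussDiagram.knot (G : GaussDiagram) : LongWKnot := Quot.mk WMove G

/-! ### Semi-virtual crossings and finite type invariants -/

/-- The coefficient of a resolution of one semi-virtual crossing of sign `ε`: a positive one is
`(crossing) - (virtual crossing)`, a negative one is `(virtual crossing) - (crossing)`. -/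
def resolutionSign (ε : ℤˣ) (virt : Prop) [Decidable virt] : ℤ :=
  if virt then -(ε : ℤ) else (ε : ℤ)

/-- The value of an Abelian-group-valued invariant `V` of long w-knots on the long w-knot with
semi-virtual crossings obtained from `G` by declaring the arrows in `S` to be semi-virtual. The
sum is over the sets `T` of semi-virtual crossings that are resolved to virtual ones. -/
def extend {M : Type*} [AddCommGroup M] (V : LongWKnot → M) (G : GaussDiagram) (S : Finset ℕ) :
    M :=
  ∑ T ∈ S.powerset, (∏ i ∈ S, resolutionSign (G.sign i) (i ∈ T)) • V (G.erase T).knot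

/-- `V` is of type `m`: it vanishes on long w-knots with more than `m` semi-virtual crossings. -/
def IsOfType {M : Type*} [AddCommGroup M] (m : ℕ) (V : LongWKnot → M) : Prop :=
  ∀ (G : GaussDiagram) (S : Finset ℕ), S ⊆ G.arrows → m < S.card → extend V G S = 0

/-- The arrow word underlying a Gauss diagram whose semi-virtual arrows are those in `S`: the
other arrows are deleted, and signs are forgotten. -/
def GaussDiagram.underlying (G : GaussDiagram) (S : Finset ℕ) : ArrowWord :=
  G.toArrowWord.erase (G.arrows \ S)

/-! ### The space of arrow diagrams -/

/-- The contents of strand `s` when elementary arrows `(name, from, to)` between three vertical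
strands are stacked on top of each other, the first one of the list coming first. -/
def stack (p : List (ℕ × Fin 3 × Fin 3)) (s : Fin 3) : List Letter :=
  p.flatMap fun a =>
    (if a.2.1 = s then [(a.1, ArrowEnd.tail)] else []) ++
      (if a.2.2 = s then [(a.1, ArrowEnd.head)] else [])

section Space

variable (𝕜 : Type*) [Field 𝕜]

/-- Formal linear combinations of arrow diagrams. -/
abbrev DiagramSpace : Type _ := ArrowDiagram →₀ 𝕜

/-- An arrow diagram as a formal linear combination. -/
noncomputable def single (D : ArrowWord) : DiagramSpace 𝕜 := Finsupp.single ⟦D⟧ 1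

/-- The relators. -/
inductive Relator : DiagramSpace 𝕜 → Prop
  /-- The 6T relation `[a₀₁, a₀₂] + [a₀₁, a₁₂] + [a₀₂, a₁₂] = 0` between diagrams in which two
  arrows are stacked on three strands, which lie in any order along the long line. -/
  | sixT (u : Fin 4 → List Letter) (π : Equiv.Perm (Fin 3)) (x y : ℕ)
      (D₁ D₂ D₃ D₄ D₅ D₆ : ArrowWord)
      (h₁ : D₁.word = place u π (stack [(x, 0, 1), (y, 0, 2)]))
      (h₂ : D₂.word = place u π (stack [(y, 0, 2), (x, 0, 1)]))
      (h₃ : D₃.word = place u π (stack [(x, 0, 1), (y, 1, 2)]))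
      (h₄ : D₄.word = place u π (stack [(y, 1, 2), (x, 0, 1)]))
      (h₅ : D₅.word = place u π (stack [(x, 0, 2), (y, 1, 2)]))
      (h₆ : D₆.word = place u π (stack [(y, 1, 2), (x, 0, 2)])) :
      Relator ((single 𝕜 D₁ - single 𝕜 D₂) + (single 𝕜 D₃ - single 𝕜 D₄)
        + (single 𝕜 D₅ - single 𝕜 D₆))
  /-- Rotation number independence: an isolated arrow pointing right equals an isolated arrow
  pointing left. -/
  | ri (u v : List Letter) (x : ℕ) (D D' : ArrowWord)
      (h : D.word = u ++ [(x, .tail), (x, .head)] ++ v)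
      (h' : D'.word = u ++ [(x, .head), (x, .tail)] ++ v) :
      Relator (single 𝕜 D - single 𝕜 D')
  /-- Tails commute. -/
  | tc (u v : List Letter) (x y : ℕ) (D D' : ArrowWord)
      (h : D.word = u ++ [(x, .tail), (y, .tail)] ++ v)
      (h' : D'.word = u ++ [(y, .tail), (x, .tail)] ++ v) :
      Relator (single 𝕜 D - single 𝕜 D')

/-- The space of arrow diagrams on a long line modulo 6T, RI and TC. -/
abbrev ASpace : Type _ := DiagramSpace 𝕜 ⧸ Submodule.span 𝕜 {x | Relator 𝕜 x}

/-- The class of an arrow diagram. -/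
noncomputable def diagramClass (D : ArrowWord) : ASpace 𝕜 :=
  Submodule.Quotient.mk (single 𝕜 D)

/-- The degree `m` part: it is spanned by the arrow diagrams with `m` arrows. -/
noncomputable def degreePart (m : ℕ) : Submodule 𝕜 (ASpace 𝕜) :=
  Submodule.span 𝕜 {a | ∃ D : ArrowWord, D.arrows.card = m ∧ a = diagramClass 𝕜 D}

/-- The graded completion, whose elements are the formal infinite sums of one element of each
degree. -/
noncomputable abbrev CompletedASpace : Type _ := ∀ m : ℕ, degreePart 𝕜 m

/-- `Z` is an expansion (a universal finite type invariant): on a long w-knot with `m` semi-virtual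
crossings and underlying arrow diagram `D` its value is `D + (terms of degree > m)`. -/
def IsExpansion (Z : LongWKnot → CompletedASpace 𝕜) : Prop :=
  ∀ (G : GaussDiagram) (S : Finset ℕ), S ⊆ G.arrows →
    (∀ k < S.card, extend Z G S k = 0) ∧
      (extend Z G S S.card : ASpace 𝕜) = diagramClass 𝕜 (G.underlying S)

/-- The degree `k` part of the result of placing a reservoir `exp(± a)` on each arrow `a` of a
Gauss diagram, the sign being that of the arrow. The sum is over the functions `n`, supported on
the arrows, with sum `k`. -/
noncomputable def reservoir (G : GaussDiagram) (k : ℕ) : ASpace 𝕜 :=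
  ∑ n ∈ G.arrows.piAntidiag k,
    (∏ i ∈ G.arrows, (((G.sign i : ℤ) : 𝕜) ^ n i / ((n i).factorial : 𝕜))) •
      diagramClass 𝕜 (G.toArrowWord.cable n)

end Space

end WKnot

/-!
The invariant `Z` is defined on Gauss diagrams by the reservoir expression. It descends to long
w-knots because this expression does not change under the moves, and it is an expansion because the
leading term of `e^{±a} - 1` is `±a`.

*Third and second Reidemeister moves.* When arrows stacked on three strands are multiplied by
stacking, the classes of the resulting diagrams define a linear map `stackMap` on a free algebra,
one for every way to complete the three strands to a line. Its syntactic congruence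
(`syntacticCon`) is a ring congruence, and in the quotient algebra the arrows `x = a₀₁`, `y = a₀₂`
and `z = a₁₂` satisfy `[x, y] = 0` (tails commute) and `[x + y, z] = 0` (what is then left of 6T).
The names of the stacked arrows do not matter (`wordClass_place_stack`), so a reservoir on stacked
arrows is the image of a product of exponential series (`reservoir_eq_of_stack`). The second move
becomes `eˣ e⁻ˣ = 1`. The third becomes `eˣ eʸ eᶻ = eˣ⁺ʸ eᶻ = eᶻ eˣ⁺ʸ = eᶻ eʸ eˣ`, or, for the other
signs, the same equation with a factor moved to the other side. The orders of the arrow ends in the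
third moves are such that, up to the order of two tails, both sides of the move are stacked arrows
(`r3Order`), the second in the opposite order.

*Spun first Reidemeister move.* The 4T relation on two strands through an isolated arrow and one
strand elsewhere says that heads pass through isolated arrows (`wordClass_isolated_head`). Thus `n`
parallel copies of an isolated arrow are equal to `n` isolated arrows, each of which can be
reversed by RI.

*Universality.* Resolving the semi-virtual crossings in `S` is an inclusion-exclusion over the
crossings at which a reservoir contributes no arrow. What survives are the terms with at least one
arrow at each crossing in `S`. There are none in degree less than `|S|`, and in degree `|S|` there
is only the underlying arrow diagram, with coefficient `∏ εᵢ · ∏ εᵢ = 1`.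
-/

namespace WKnot

/-! ### Exponential power series over a noncommutative algebra -/

section ExpSeries

variable (𝕜 : Type*) [Field 𝕜] {A B : Type*} [Ring A] [Algebra 𝕜 A] [Ring B] [Algebra 𝕜 B]

/-- The series `∑ bⁿ tⁿ / n!`. The central variable `t` records the degree, so that identities
between exponentials make sense without a topology on the algebra. -/
noncomputable def expSeries (b : B) : PowerSeries B :=
  PowerSeries.mk fun n => (n.factorial : 𝕜)⁻¹ • b ^ n

@[simp] theorem expSeries_zero : expSeries 𝕜 (0 : B) = 1 := by
  ext n
  rcases n with _ | n <;> simp [expSeries, PowerSeries.coeff_one]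

theorem map_expSeries (f : A →ₐ[𝕜] B) (a : A) :
    PowerSeries.map (f : A →+* B) (expSeries 𝕜 a) = expSeries 𝕜 (f a) := by
  ext n
  simp [expSeries]

variable [CharZero 𝕜]

theorem expSeries_add {a b : B} (h : Commute a b) :
    expSeries 𝕜 (a + b) = expSeries 𝕜 a * expSeries 𝕜 b := by
  ext n
  simp only [expSeries, PowerSeries.coeff_mul, PowerSeries.coeff_mk, h.add_pow', Finset.smul_sum]
  refine Finset.sum_congr rfl fun p hp => ?_
  obtain rfl := Finset.HasAntidiagonal.mem_antidiagonal.1 hp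
  have h1 : ((p.1 + p.2).factorial : 𝕜) ≠ 0 := by exact_mod_cast Nat.factorial_ne_zero _
  have h2 : (p.1.factorial : 𝕜) ≠ 0 := by exact_mod_cast Nat.factorial_ne_zero _
  have h3 : (p.2.factorial : 𝕜) ≠ 0 := by exact_mod_cast Nat.factorial_ne_zero _
  rw [smul_mul_smul_comm, ← Nat.cast_smul_eq_nsmul 𝕜, smul_smul, Nat.cast_add_choose]
  congr 1
  field_simp

theorem commute_expSeries {a b : B} (h : Commute a b) :
    Commute (expSeries 𝕜 a) (expSeries 𝕜 b) := by
  rw [Commute, SemiconjBy, ← expSeries_add 𝕜 h, ← expSeries_add 𝕜 h.symm, add_comm]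

theorem expSeries_mul_neg (a : B) : expSeries 𝕜 a * expSeries 𝕜 (-a) = 1 := by
  rw [← expSeries_add 𝕜 (Commute.refl a).neg_right, add_neg_cancel, expSeries_zero]

theorem expSeries_neg_mul (a : B) : expSeries 𝕜 (-a) * expSeries 𝕜 a = 1 := by
  rw [← expSeries_add 𝕜 (Commute.refl a).neg_left, neg_add_cancel, expSeries_zero]

/-- The Yang–Baxter equation for exponentials when the tails commute (`hxy`) and the 4T relation
(`hz`) holds. -/
theorem expSeries_yangBaxter {x y z : B} (hxy : Commute x y) (hz : Commute (x + y) z) :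
    expSeries 𝕜 x * expSeries 𝕜 y * expSeries 𝕜 z =
      expSeries 𝕜 z * expSeries 𝕜 y * expSeries 𝕜 x := by
  rw [mul_assoc (expSeries 𝕜 z), ← (commute_expSeries 𝕜 hxy).eq, ← expSeries_add 𝕜 hxy]
  exact (commute_expSeries 𝕜 hz).eq

/-- The form of `expSeries_yangBaxter` in which one of the commuting factors, inverted, has been
moved to the other side of the equation. -/
theorem expSeries_yangBaxter_neg {x y z : B} (hxy : Commute x y) (hz : Commute (x + y) z) :
    expSeries 𝕜 (-y) * expSeries 𝕜 z * expSeries 𝕜 x =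
      expSeries 𝕜 x * expSeries 𝕜 z * expSeries 𝕜 (-y) := by
  have h := expSeries_yangBaxter 𝕜 hxy hz
  rw [(commute_expSeries 𝕜 hxy).eq] at h
  calc expSeries 𝕜 (-y) * expSeries 𝕜 z * expSeries 𝕜 x
      = expSeries 𝕜 (-y) * (expSeries 𝕜 z * (expSeries 𝕜 y * expSeries 𝕜 x)) *
          expSeries 𝕜 (-y) := by
        rw [← (commute_expSeries 𝕜 hxy).eq, ← mul_assoc, mul_assoc _ _ (expSeries 𝕜 (-y)),
          mul_assoc _ (expSeries 𝕜 y), expSeries_mul_neg, mul_one]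
    _ = expSeries 𝕜 (-y) * (expSeries 𝕜 y * expSeries 𝕜 x * expSeries 𝕜 z) *
          expSeries 𝕜 (-y) := by rw [h, ← mul_assoc (expSeries 𝕜 z)]
    _ = _ := by
        rw [mul_assoc (expSeries 𝕜 y), ← mul_assoc (expSeries 𝕜 (-y)) (expSeries 𝕜 y),
          expSeries_neg_mul, one_mul]

end ExpSeries

theorem coeff_prod_mk {R ι : Type*} [Semiring R] (key : ι → ℕ) (f : ι → ℕ → R) :
    ∀ (o : List ι), (o.map key).Nodup → ∀ N : ℕ,
      PowerSeries.coeff N (o.map fun a => PowerSeries.mk (f a)).prod =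
        ∑ h ∈ (o.map key).toFinset.piAntidiag N, (o.map fun a => f a (h (key a))).prod
  | [], _, N => by
    rcases N with _ | N <;> simp [PowerSeries.coeff_one]
  | a :: o, hn, N => by
    rw [List.map_cons, List.nodup_cons] at hn
    have ha : key a ∉ (o.map key).toFinset := by simpa using hn.1
    rw [List.map_cons, List.map_cons, List.toFinset_cons, ← Finset.cons_eq_insert _ _ ha,
      Finset.piAntidiag_cons, Finset.sum_disjiUnion, List.prod_cons, PowerSeries.coeff_mul]
    refine Finset.sum_congr rfl fun p hp => ?_
    rw [coeff_prod_mk key f o hn.2, PowerSeries.coeff_mk, Finset.mul_sum, Finset.sum_map]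
    refine Finset.sum_congr rfl fun h hh => ?_
    have h0 : h (key a) = 0 := by
      by_contra h0
      exact ha ((Finset.mem_piAntidiag.1 hh).2 _ h0)
    rw [List.map_cons, List.prod_cons]
    congr 2
    · simp [h0]
    · refine List.map_congr_left fun b hb => ?_
      have : key b ≠ key a := fun e => hn.1 (e ▸ List.mem_map_of_mem hb)
      simp [this]

theorem sum_piAntidiag_union {M : Type*} [AddCommMonoid M] {s t : Finset ℕ} (hst : Disjoint s t)
    (k : ℕ) (F : (ℕ → ℕ) → M) :
    ∑ n ∈ (s ∪ t).piAntidiag k, F n = ∑ p ∈ Finset.HasAntidiagonal.antidiagonal k,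
      ∑ g ∈ s.piAntidiag p.1, ∑ h ∈ t.piAntidiag p.2, F (g + h) := by
  have hd : ∀ i, i ∈ s → i ∉ t := fun i hi hi' => (Finset.disjoint_left.1 hst) hi hi'
  have hz : ∀ {u : Finset ℕ} {q : ℕ} {n : ℕ → ℕ}, n ∈ u.piAntidiag q → ∀ i, i ∉ u → n i = 0 :=
    fun hn i hi => by
      by_contra h
      exact hi ((Finset.mem_piAntidiag.1 hn).2 i h)
  simp only [← Finset.sum_product']
  rw [Finset.sum_sigma']
  symm
  refine Finset.sum_bij'
    (fun (x : Σ _ : ℕ × ℕ, (ℕ → ℕ) × (ℕ → ℕ)) _ => x.2.1 + x.2.2)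
    (fun n _ => ⟨(∑ i ∈ s, n i, ∑ i ∈ t, n i),
      ((fun i => if i ∈ s then n i else 0), (fun i => if i ∈ t then n i else 0))⟩) ?_ ?_ ?_ ?_ ?_
  · rintro ⟨p, g, h⟩ hx
    simp only [Finset.mem_sigma, Finset.HasAntidiagonal.mem_antidiagonal, Finset.mem_product] at hx
    obtain ⟨hp, hg, hh⟩ := hx
    have hg' := hz hg
    have hh' := hz hh
    rw [Finset.mem_piAntidiag] at hg hh ⊢
    refine ⟨?_, fun i hi => ?_⟩
    · rw [Finset.sum_union hst, ← hp, ← hg.1, ← hh.1]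
      congr 1
      · exact Finset.sum_congr rfl fun i hi => by simp [hh' i (hd i hi)]
      · exact Finset.sum_congr rfl fun i hi => by simp [hg' i (fun h => hd i h hi)]
    · by_contra hc
      rw [Finset.mem_union, not_or] at hc
      simp [hg' i hc.1, hh' i hc.2] at hi
  · intro n hn
    rw [Finset.mem_piAntidiag, Finset.sum_union hst] at hn
    simp only [Finset.mem_sigma, Finset.HasAntidiagonal.mem_antidiagonal, Finset.mem_product,
      Finset.mem_piAntidiag]
    refine ⟨hn.1, ⟨?_, ?_⟩, ?_, ?_⟩
    · exact Finset.sum_congr rfl fun i hi => by simp [hi]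
    · intro i hi
      by_contra hc
      simp [hc] at hi
    · exact Finset.sum_congr rfl fun i hi => by simp [hi]
    · intro i hi
      by_contra hc
      simp [hc] at hi
  · rintro ⟨⟨p, q⟩, g, h⟩ hx
    simp only [Finset.mem_sigma, Finset.HasAntidiagonal.mem_antidiagonal, Finset.mem_product] at hx
    obtain ⟨hp, hg, hh⟩ := hx
    have hg' := hz hg
    have hh' := hz hh
    have e1 : (fun i => if i ∈ s then (g + h) i else 0) = g := by
      funext i
      by_cases hi : i ∈ s
      · simp [hi, hh' i (hd i hi)]
      · simp [hi, hg' i hi]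
    have e2 : (fun i => if i ∈ t then (g + h) i else 0) = h := by
      funext i
      by_cases hi : i ∈ t
      · simp [hi, hg' i (fun h => hd i h hi)]
      · simp [hi, hh' i hi]
    have e3 : ∑ i ∈ s, (g + h) i = p := by
      rw [← (Finset.mem_piAntidiag.1 hg).1]
      exact Finset.sum_congr rfl fun i hi => by simp [hh' i (hd i hi)]
    have e4 : ∑ i ∈ t, (g + h) i = q := by
      rw [← (Finset.mem_piAntidiag.1 hh).1]
      exact Finset.sum_congr rfl fun i hi => by simp [hg' i (fun h => hd i h hi)]
    simp only [e1, e2, e3, e4]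
  · intro n hn
    funext i
    by_cases hi : i ∈ s
    · simp [hi, hd i hi]
    · by_cases hi' : i ∈ t
      · simp [hi, hi']
      · have := hz hn i (by simp [hi, hi'])
        simp [hi, hi', this]
  · intro x _
    rfl

/-! ### Classes of words in the space of arrow diagrams -/

/-- The conditions under which a word is an arrow word. -/
def Valid (w : List Letter) : Prop :=
  w.Nodup ∧ ∀ i, (i, ArrowEnd.tail) ∈ w ↔ (i, ArrowEnd.head) ∈ w

theorem Valid.perm {w w' : List Letter} (h : Valid w) (hw : w.Perm w') : Valid w' :=
  ⟨hw.nodup_iff.1 h.1, fun i => by rw [← hw.mem_iff, ← hw.mem_iff, h.2 i]⟩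

theorem valid_perm_iff {w w' : List Letter} (hw : w.Perm w') : Valid w ↔ Valid w' :=
  ⟨fun h => h.perm hw, fun h => h.perm hw.symm⟩

theorem ArrowWord.valid (D : ArrowWord) : Valid D.word := ⟨D.nodup, D.matched⟩

/-- Replace the name of each arrow by its image under `f`. -/
def mapNames (f : ℕ → ℕ) (w : List Letter) : List Letter := w.map fun l => (f l.1, l.2)

theorem exists_perm_of_injOn {f : ℕ → ℕ} (s : Finset ℕ) (hf : Set.InjOn f s) :
    ∃ σ : Equiv.Perm ℕ, ∀ i ∈ s, σ i = f i := by
  obtain ⟨g, hg⟩ := Cardinal.extend_function_of_lt (s := (s : Set ℕ))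
    ⟨fun x => f x, fun a b h => Subtype.ext (hf a.2 b.2 h)⟩
    (by simp) ⟨Equiv.refl ℕ⟩
  exact ⟨g, fun i hi => hg ⟨i, hi⟩⟩

section

variable (𝕜 : Type*) [Field 𝕜]

open Classical in
/-- The class of a word, which is `0` if the word is not an arrow word. -/
noncomputable def wordClass (w : List Letter) : ASpace 𝕜 :=
  if h : Valid w then diagramClass 𝕜 ⟨w, h.1, h.2⟩ else 0

theorem wordClass_word (D : ArrowWord) : wordClass 𝕜 D.word = diagramClass 𝕜 D := by
  rw [wordClass, dif_pos D.valid]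

theorem wordClass_of_valid {w : List Letter} (h : Valid w) :
    wordClass 𝕜 w = diagramClass 𝕜 ⟨w, h.1, h.2⟩ := dif_pos h

theorem wordClass_of_not_valid {w : List Letter} (h : ¬ Valid w) : wordClass 𝕜 w = 0 := dif_neg h

theorem valid_rename (σ : Equiv.Perm ℕ) {w : List Letter} (h : Valid w) : Valid (rename σ w) := by
  have hm : ∀ i e, (i, e) ∈ rename σ w ↔ (σ.symm i, e) ∈ w := by
    intro i e
    simp only [rename, List.mem_map, Prod.mk.injEq, Prod.exists]
    constructor
    · rintro ⟨a, b, hab, rfl, rfl⟩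
      simpa using hab
    · intro hi
      exact ⟨_, _, hi, by simp, rfl⟩
  refine ⟨h.1.map fun a b hab => ?_, fun i => by rw [hm, hm, h.2]⟩
  simp only [Prod.mk.injEq, EmbeddingLike.apply_eq_iff_eq] at hab
  exact Prod.ext hab.1 hab.2

theorem wordClass_rename (σ : Equiv.Perm ℕ) (w : List Letter) :
    wordClass 𝕜 (rename σ w) = wordClass 𝕜 w := by
  by_cases h : Valid w
  · rw [wordClass_of_valid 𝕜 h, wordClass_of_valid 𝕜 (valid_rename σ h), diagramClass,
      diagramClass, single, single]
    congr 2
    exact Quotient.sound ⟨σ⁻¹, by simp [rename_rename, rename_one]⟩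
  · rw [wordClass_of_not_valid 𝕜 h, wordClass_of_not_valid]
    intro h'
    apply h
    simpa [rename_rename, rename_one] using valid_rename σ⁻¹ h'

theorem wordClass_mapNames (f : ℕ → ℕ) (w : List Letter)
    (hf : Set.InjOn f ((w.map Prod.fst).toFinset : Set ℕ)) :
    wordClass 𝕜 (mapNames f w) = wordClass 𝕜 w := by
  obtain ⟨σ, hσ⟩ := exists_perm_of_injOn _ hf
  have : mapNames f w = rename σ w := List.map_congr_left fun l hl => by
    rw [hσ l.1 (by simpa using ⟨l.2, hl⟩)]
  rw [this, wordClass_rename]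

/-- Tails commute. -/
theorem wordClass_tc (u v : List Letter) (x y : ℕ) :
    wordClass 𝕜 (u ++ [(x, .tail), (y, .tail)] ++ v) =
      wordClass 𝕜 (u ++ [(y, .tail), (x, .tail)] ++ v) := by
  have hp : (u ++ [(x, ArrowEnd.tail), (y, ArrowEnd.tail)] ++ v).Perm
      (u ++ [(y, ArrowEnd.tail), (x, ArrowEnd.tail)] ++ v) :=
    ((List.Perm.swap _ _ _).append_left u).append_right v
  by_cases h : Valid (u ++ [(x, ArrowEnd.tail), (y, ArrowEnd.tail)] ++ v)
  · rw [wordClass_of_valid 𝕜 h, wordClass_of_valid 𝕜 (h.perm hp), diagramClass, diagramClass]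
    exact (Submodule.Quotient.eq _).2 (Submodule.subset_span (Relator.tc u v x y _ _ rfl rfl))
  · rw [wordClass_of_not_valid 𝕜 h, wordClass_of_not_valid 𝕜 (mt (valid_perm_iff hp).2 h)]

/-- An isolated arrow may be reversed. -/
theorem wordClass_ri (u v : List Letter) (x : ℕ) :
    wordClass 𝕜 (u ++ [(x, .tail), (x, .head)] ++ v) =
      wordClass 𝕜 (u ++ [(x, .head), (x, .tail)] ++ v) := by
  have hp : (u ++ [(x, ArrowEnd.tail), (x, ArrowEnd.head)] ++ v).Perm
      (u ++ [(x, ArrowEnd.head), (x, ArrowEnd.tail)] ++ v) :=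
    ((List.Perm.swap _ _ _).append_left u).append_right v
  by_cases h : Valid (u ++ [(x, ArrowEnd.tail), (x, ArrowEnd.head)] ++ v)
  · rw [wordClass_of_valid 𝕜 h, wordClass_of_valid 𝕜 (h.perm hp), diagramClass, diagramClass]
    exact (Submodule.Quotient.eq _).2 (Submodule.subset_span (Relator.ri u v x _ _ rfl rfl))
  · rw [wordClass_of_not_valid 𝕜 h, wordClass_of_not_valid 𝕜 (mt (valid_perm_iff hp).2 h)]

/-- A block of tails may be permuted. -/
theorem wordClass_perm_tails {l l' : List ℕ} (h : l.Perm l') : ∀ u v : List Letter,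
    wordClass 𝕜 (u ++ l.map (·, ArrowEnd.tail) ++ v) =
      wordClass 𝕜 (u ++ l'.map (·, ArrowEnd.tail) ++ v) := by
  induction h with
  | nil => simp
  | cons x _ ih =>
    intro u v
    have h := ih (u ++ [(x, .tail)]) v
    simp only [List.append_assoc, List.map_cons, List.cons_append, List.nil_append] at h ⊢
    exact h
  | swap x y l =>
    intro u v
    simpa using wordClass_tc 𝕜 u (l.map (·, ArrowEnd.tail) ++ v) y x
  | trans _ _ ih₁ ih₂ => exact fun u v => (ih₁ u v).trans (ih₂ u v)

end

theorem count_place (u : Fin 4 → List Letter) (π : Equiv.Perm (Fin 3)) (c : Fin 3 → List Letter)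
    (l : Letter) :
    (place u π c).count l = ∑ k, (u k).count l + ∑ s, (c s).count l := by
  rw [← Equiv.sum_comp π, Fin.sum_univ_three, Fin.sum_univ_four]
  simp only [place, List.count_append]
  ring

theorem mem_place {u : Fin 4 → List Letter} {π : Equiv.Perm (Fin 3)} {c : Fin 3 → List Letter}
    {l : Letter} : l ∈ place u π c ↔ (∃ k, l ∈ u k) ∨ ∃ s, l ∈ c s := by
  simp only [← List.count_pos_iff, count_place]
  rw [Nat.add_pos_iff_pos_or_pos, Finset.sum_pos_iff, Finset.sum_pos_iff]
  simp

/-- The contents of a single strand occur in a word as one block, the rest of the word not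
depending on them. -/
theorem exists_place_update (u : Fin 4 → List Letter) (π : Equiv.Perm (Fin 3))
    (c : Fin 3 → List Letter) (s : Fin 3) :
    ∃ A B : List Letter, ∀ l, place u π (Function.update c s l) = A ++ l ++ B := by
  obtain ⟨r, rfl⟩ := π.surjective s
  fin_cases r
  · exact ⟨u 0, u 1 ++ c (π 1) ++ u 2 ++ c (π 2) ++ u 3, fun l => by simp [place]⟩
  · exact ⟨u 0 ++ c (π 0) ++ u 1, u 2 ++ c (π 2) ++ u 3, fun l => by simp [place]⟩
  · exact ⟨u 0 ++ c (π 0) ++ u 1 ++ c (π 1) ++ u 2, u 3, fun l => by simp [place]⟩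

theorem place_map (f : Letter → Letter) (u : Fin 4 → List Letter) (π : Equiv.Perm (Fin 3))
    (c : Fin 3 → List Letter) :
    (place u π c).map f = place (fun k => (u k).map f) π fun s => (c s).map f := by
  simp [place]

theorem stack_append (p q : List (ℕ × Fin 3 × Fin 3)) (s : Fin 3) :
    stack (p ++ q) s = stack p s ++ stack q s := by
  simp [stack]

theorem mapNames_stack (f : ℕ → ℕ) (p : List (ℕ × Fin 3 × Fin 3)) (s : Fin 3) :
    mapNames f (stack p s) = stack (p.map fun a => (f a.1, a.2)) s := by
  simp only [stack, mapNames, List.map_flatMap, List.flatMap_map]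
  refine List.flatMap_congr fun a _ => ?_
  split_ifs <;> simp

/-- Arrows at the bottom and at the top of three strands can be counted to the rest of the line. -/
theorem exists_place_stack_eq (u : Fin 4 → List Letter) (π : Equiv.Perm (Fin 3))
    (a b : List (ℕ × Fin 3 × Fin 3)) :
    ∃ u' : Fin 4 → List Letter, ∀ q,
      place u π (stack (a ++ q ++ b)) = place u' π (stack q) :=
  ⟨![u 0 ++ stack a (π 0), stack b (π 0) ++ u 1 ++ stack a (π 1),
    stack b (π 1) ++ u 2 ++ stack a (π 2), stack b (π 2) ++ u 3], fun q => by
    simp [place, stack_append]⟩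

theorem fst_mem_of_mem_stack {q : List (ℕ × Fin 3 × Fin 3)} {s : Fin 3} {l : Letter}
    (h : l ∈ stack q s) : l.1 ∈ q.map Prod.fst := by
  simp only [stack, List.mem_flatMap, List.mem_append] at h
  obtain ⟨a, ha, h⟩ := h
  refine List.mem_map.2 ⟨a, ha, ?_⟩
  split_ifs at h <;> simp at h <;> aesop

theorem sum_count_stack (i : ℕ) (e : ArrowEnd) : ∀ q : List (ℕ × Fin 3 × Fin 3),
    ∑ s, (stack q s).count (i, e) = (q.map Prod.fst).count i
  | [] => by simp [stack]
  | a :: q => by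
    have h : ∀ s, stack (a :: q) s = stack [a] s ++ stack q s := fun s => stack_append [a] q s
    simp only [h, List.count_append, Finset.sum_add_distrib, sum_count_stack i e q, List.map_cons,
      List.count_cons]
    rw [add_comm]
    congr 1
    obtain ⟨a, s, t⟩ := a
    have ht : ∀ s t r : Fin 3, ∀ x : ℕ, (stack [(x, s, t)] r).count (i, e) =
        (if s = r then if x = i ∧ ArrowEnd.tail = e then 1 else 0 else 0) +
          if t = r then if x = i ∧ ArrowEnd.head = e then 1 else 0 else 0 := by
      intro s t r x
      simp only [stack, List.flatMap_cons, List.flatMap_nil, List.append_nil, List.count_append]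
      congr 1 <;> split_ifs <;> simp_all
    simp only [ht, Finset.sum_add_distrib, Finset.sum_ite_eq, Finset.mem_univ, if_true]
    cases e <;> simp

theorem place_stack_perm {q q' : List (ℕ × Fin 3 × Fin 3)}
    (h : (q.map Prod.fst).Perm (q'.map Prod.fst)) (u : Fin 4 → List Letter)
    (π : Equiv.Perm (Fin 3)) : (place u π (stack q)).Perm (place u π (stack q')) := by
  rw [List.perm_iff_count]
  rintro ⟨i, e⟩
  rw [count_place, count_place, sum_count_stack, sum_count_stack, h.count_eq]

section

variable (𝕜 : Type*) [Field 𝕜]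

theorem wordClass_sixT (u : Fin 4 → List Letter) (π : Equiv.Perm (Fin 3)) (x y : ℕ) :
    (wordClass 𝕜 (place u π (stack [(x, 0, 1), (y, 0, 2)])) -
        wordClass 𝕜 (place u π (stack [(y, 0, 2), (x, 0, 1)]))) +
      (wordClass 𝕜 (place u π (stack [(x, 0, 1), (y, 1, 2)])) -
        wordClass 𝕜 (place u π (stack [(y, 1, 2), (x, 0, 1)]))) +
      (wordClass 𝕜 (place u π (stack [(x, 0, 2), (y, 1, 2)])) -
        wordClass 𝕜 (place u π (stack [(y, 1, 2), (x, 0, 2)]))) = 0 := by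
  have h₂ : (place u π (stack [(x, 0, 1), (y, 0, 2)])).Perm
      (place u π (stack [(y, 0, 2), (x, 0, 1)])) :=
    place_stack_perm (by simp [List.Perm.swap]) u π
  have h₃ : (place u π (stack [(x, 0, 1), (y, 0, 2)])).Perm
      (place u π (stack [(x, 0, 1), (y, 1, 2)])) :=
    place_stack_perm (by simp) u π
  have h₄ : (place u π (stack [(x, 0, 1), (y, 0, 2)])).Perm
      (place u π (stack [(y, 1, 2), (x, 0, 1)])) :=
    place_stack_perm (by simp [List.Perm.swap]) u π
  have h₅ : (place u π (stack [(x, 0, 1), (y, 0, 2)])).Perm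
      (place u π (stack [(x, 0, 2), (y, 1, 2)])) :=
    place_stack_perm (by simp) u π
  have h₆ : (place u π (stack [(x, 0, 1), (y, 0, 2)])).Perm
      (place u π (stack [(y, 1, 2), (x, 0, 2)])) :=
    place_stack_perm (by simp [List.Perm.swap]) u π
  by_cases h : Valid (place u π (stack [(x, 0, 1), (y, 0, 2)]))
  · rw [wordClass_of_valid 𝕜 h, wordClass_of_valid 𝕜 (h.perm h₂), wordClass_of_valid 𝕜 (h.perm h₃),
      wordClass_of_valid 𝕜 (h.perm h₄), wordClass_of_valid 𝕜 (h.perm h₅),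
      wordClass_of_valid 𝕜 (h.perm h₆)]
    simp only [diagramClass, ← Submodule.Quotient.mk_sub, ← Submodule.Quotient.mk_add]
    exact (Submodule.Quotient.mk_eq_zero _).2 (Submodule.subset_span
      (Relator.sixT u π x y _ _ _ _ _ _ rfl rfl rfl rfl rfl rfl))
  · rw [wordClass_of_not_valid 𝕜 h, wordClass_of_not_valid 𝕜 (mt (valid_perm_iff h₂).2 h),
      wordClass_of_not_valid 𝕜 (mt (valid_perm_iff h₃).2 h),
      wordClass_of_not_valid 𝕜 (mt (valid_perm_iff h₄).2 h),
      wordClass_of_not_valid 𝕜 (mt (valid_perm_iff h₅).2 h),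
      wordClass_of_not_valid 𝕜 (mt (valid_perm_iff h₆).2 h)]
    simp

theorem wordClass_stack_tc (u : Fin 4 → List Letter) (π : Equiv.Perm (Fin 3)) (x y : ℕ) :
    wordClass 𝕜 (place u π (stack [(x, 0, 1), (y, 0, 2)])) =
      wordClass 𝕜 (place u π (stack [(y, 0, 2), (x, 0, 1)])) := by
  obtain ⟨A, B, h⟩ := exists_place_update u π (stack [(x, 0, 1), (y, 0, 2)]) 0
  have h₁ : stack [(x, 0, 1), (y, 0, 2)] = Function.update (stack [(x, 0, 1), (y, 0, 2)]) 0
      [(x, .tail), (y, .tail)] := by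
    funext s; fin_cases s <;> simp [stack]
  have h₂ : stack [(y, 0, 2), (x, 0, 1)] = Function.update (stack [(x, 0, 1), (y, 0, 2)]) 0
      [(y, .tail), (x, .tail)] := by
    funext s; fin_cases s <;> simp [stack]
  rw [h₂, h, ← wordClass_tc, ← h, ← h₁]

/-- The 4T relation, which is what remains of 6T when tails commute. -/
theorem wordClass_fourT (u : Fin 4 → List Letter) (π : Equiv.Perm (Fin 3)) (x y : ℕ) :
    (wordClass 𝕜 (place u π (stack [(x, 0, 1), (y, 1, 2)])) -
        wordClass 𝕜 (place u π (stack [(y, 1, 2), (x, 0, 1)]))) +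
      (wordClass 𝕜 (place u π (stack [(x, 0, 2), (y, 1, 2)])) -
        wordClass 𝕜 (place u π (stack [(y, 1, 2), (x, 0, 2)]))) = 0 := by
  have h := wordClass_sixT 𝕜 u π x y
  rwa [wordClass_stack_tc, sub_self, zero_add] at h

end

/-! ### The algebra of arrows on three strands -/

/-- A name larger than those of the arrows with an end in `u`. -/
def freshName (u : Fin 4 → List Letter) : ℕ :=
  ((u 0 ++ u 1 ++ u 2 ++ u 3).map Prod.fst).sum + 1

theorem lt_freshName {u : Fin 4 → List Letter} {k : Fin 4} {l : Letter} (h : l ∈ u k) :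
    l.1 < freshName u := by
  refine Nat.lt_succ_of_le (List.le_sum_of_mem (List.mem_map_of_mem ?_))
  fin_cases k <;> simp_all

/-- Stacked arrows with the names `N`, `N + 1`, … . -/
def named (N : ℕ) (p : List (Fin 3 × Fin 3)) : List (ℕ × Fin 3 × Fin 3) :=
  (p.zipIdx N).map Prod.swap

theorem named_map_snd (N : ℕ) (p : List (Fin 3 × Fin 3)) : (named N p).map Prod.snd = p := by
  rw [named, List.map_map]
  exact List.zipIdx_map_fst N p

theorem named_map_fst (N : ℕ) (p : List (Fin 3 × Fin 3)) :
    (named N p).map Prod.fst = List.range' N p.length := by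
  rw [named, List.map_map]
  exact List.zipIdx_map_snd N p

section

variable (𝕜 : Type*) [Field 𝕜]

/-- The class of the diagram in which arrows are stacked on three strands of a line with rest `u`,
the arrows getting names that do not occur in `u`. -/
noncomputable def stackClass (u : Fin 4 → List Letter) (π : Equiv.Perm (Fin 3))
    (p : List (Fin 3 × Fin 3)) : ASpace 𝕜 :=
  wordClass 𝕜 (place u π (stack (named (freshName u) p)))

/-- The names of the stacked arrows are irrelevant. -/
theorem wordClass_place_stack {u : Fin 4 → List Letter} {π : Equiv.Perm (Fin 3)}
    {q : List (ℕ × Fin 3 × Fin 3)} (hq : (q.map Prod.fst).Nodup)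
    (hu : ∀ k, ∀ l ∈ u k, l.1 ∉ q.map Prod.fst) :
    wordClass 𝕜 (place u π (stack q)) = stackClass 𝕜 u π (q.map Prod.snd) := by
  set N := freshName u with hN
  let f : ℕ → ℕ := fun n => if n < N then n else (q.map Prod.fst).getD (n - N) 0
  have hfu : ∀ k, mapNames f (u k) = u k := fun k => by
    refine (List.map_congr_left fun l hl => ?_).trans (List.map_id _)
    have : l.1 < N := lt_freshName hl
    simp [f, this]
  have hfq : (named N (q.map Prod.snd)).map (fun a => (f a.1, a.2)) = q := by
    refine List.ext_getElem (by simp [named]) fun i h₁ h₂ => ?_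
    simp [named, f, h₂]
  have hw : place u π (stack q) =
      mapNames f (place u π (stack (named N (q.map Prod.snd)))) := by
    rw [mapNames, place_map]
    congr 1
    · exact funext fun k => (hfu k).symm
    · funext s
      exact (congrArg (stack · s) hfq.symm).trans (mapNames_stack f _ s).symm
  rw [hw, stackClass, wordClass_mapNames]
  have hlen : (q.map Prod.fst).length = q.length := by simp
  have key : ∀ i, i ∈ ((place u π (stack (named N (q.map Prod.snd)))).map Prod.fst).toFinset →
      (i < N ∧ f i = i ∧ ∃ k, ∃ l ∈ u k, l.1 = i) ∨
        (∃ h : i - N < (q.map Prod.fst).length, N ≤ i ∧ f i = (q.map Prod.fst)[i - N]) := by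
    intro i hi
    simp only [List.mem_toFinset, List.mem_map, mem_place] at hi
    obtain ⟨l, ⟨k, hl⟩ | ⟨s, hl⟩, rfl⟩ := hi
    · have : l.1 < N := lt_freshName hl
      exact Or.inl ⟨this, by simp [f, this], k, l, hl, rfl⟩
    · have h := fst_mem_of_mem_stack hl
      rw [named_map_fst, List.mem_range'_1, List.length_map] at h
      have h' : l.1 - N < (q.map Prod.fst).length := by rw [hlen]; omega
      refine Or.inr ⟨h', h.1, ?_⟩
      simp only [f, if_neg (not_lt.2 h.1)]
      rw [List.getD_eq_getElem _ _ h']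
  intro i hi j hj hij
  rcases key i (by exact_mod_cast hi) with ⟨h₁, h₂, k, l, hl, rfl⟩ | ⟨h₁, h₂, h₃⟩ <;>
    rcases key j (by exact_mod_cast hj) with ⟨g₁, g₂, k', l', hl', rfl⟩ | ⟨g₁, g₂, g₃⟩
  · rw [← h₂, ← g₂, hij]
  · refine absurd ?_ (hu k l hl)
    rw [← h₂, hij, g₃]
    exact List.getElem_mem _
  · refine absurd ?_ (hu k' l' hl')
    rw [← g₂, ← hij, h₃]
    exact List.getElem_mem _
  · have := (List.Nodup.getElem_inj_iff hq).1 (h₃.symm.trans (hij.trans g₃))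
    omega

/-- Two consecutive stacked arrows can be isolated from the other ones, which are counted to the
rest of the line. -/
theorem exists_stackClass_eq (u : Fin 4 → List Letter) (π : Equiv.Perm (Fin 3))
    (a b : List (Fin 3 × Fin 3)) :
    ∃ (u' : Fin 4 → List Letter) (x y : ℕ), ∀ c d,
      stackClass 𝕜 u π (a ++ [c, d] ++ b) =
          wordClass 𝕜 (place u' π (stack [(x, c), (y, d)])) ∧
        stackClass 𝕜 u π (a ++ [c, d] ++ b) =
          wordClass 𝕜 (place u' π (stack [(y, c), (x, d)])) := by
  set N := freshName u with hN
  obtain ⟨u', hu'⟩ := exists_place_stack_eq u π (named (N + 2) a) (named (N + 2 + a.length) b)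
  have hnd : ∀ x y : ℕ, [x, y].Perm [N, N + 1] → ∀ c d,
      stackClass 𝕜 u π (a ++ [c, d] ++ b) =
        wordClass 𝕜 (place u' π (stack [(x, c), (y, d)])) := by
    intro x y hxy c d
    have hnames : ((named (N + 2) a ++ [(x, c), (y, d)] ++
        named (N + 2 + a.length) b).map Prod.fst).Perm
          (List.range' N (2 + a.length + b.length)) := by
      rw [List.map_append, List.map_append, named_map_fst, named_map_fst]
      have : List.range' N (2 + a.length + b.length) =
          [N, N + 1] ++ List.range' (N + 2) a.length ++
            List.range' (N + 2 + a.length) b.length := by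
        rw [← List.range'_append_1, ← List.range'_append_1]
        simp [List.range'_succ, add_assoc]
      rw [this]
      exact (List.perm_append_comm.trans (List.Perm.append_right _ hxy)).append_right _
    rw [← hu', wordClass_place_stack]
    · simp [named_map_snd]
    · exact hnames.nodup_iff.2 List.nodup_range'
    · intro k l hl hl'
      have h := hnames.mem_iff.1 hl'
      rw [List.mem_range'_1] at h
      exact absurd (lt_freshName hl) (not_lt.2 h.1)
  exact ⟨u', N, N + 1, fun c d => ⟨hnd _ _ (List.Perm.refl _) c d,
    hnd _ _ (List.Perm.swap _ _ _) c d⟩⟩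

theorem stackClass_tc (u : Fin 4 → List Letter) (π : Equiv.Perm (Fin 3))
    (a b : List (Fin 3 × Fin 3)) :
    stackClass 𝕜 u π (a ++ [(0, 1), (0, 2)] ++ b) =
      stackClass 𝕜 u π (a ++ [(0, 2), (0, 1)] ++ b) := by
  obtain ⟨u', x, y, h⟩ := exists_stackClass_eq 𝕜 u π a b
  rw [(h _ _).1, (h _ _).2, wordClass_stack_tc]

theorem stackClass_fourT (u : Fin 4 → List Letter) (π : Equiv.Perm (Fin 3))
    (a b : List (Fin 3 × Fin 3)) :
    (stackClass 𝕜 u π (a ++ [(0, 1), (1, 2)] ++ b) -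
        stackClass 𝕜 u π (a ++ [(1, 2), (0, 1)] ++ b)) +
      (stackClass 𝕜 u π (a ++ [(0, 2), (1, 2)] ++ b) -
        stackClass 𝕜 u π (a ++ [(1, 2), (0, 2)] ++ b)) = 0 := by
  obtain ⟨u', x, y, h⟩ := exists_stackClass_eq 𝕜 u π a b
  rw [(h (0, 1) _).1, (h _ (0, 1)).2, (h (0, 2) _).1, (h _ (0, 2)).2, wordClass_fourT]

/-- The free algebra on the elementary arrows between three strands. -/
abbrev StackAlgebra : Type _ := MonoidAlgebra 𝕜 (FreeMonoid (Fin 3 × Fin 3))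

/-- An elementary arrow, as an element of the free algebra. -/
noncomputable def stackArrow (c : Fin 3 × Fin 3) : StackAlgebra 𝕜 :=
  MonoidAlgebra.of 𝕜 _ (FreeMonoid.of c)

/-- The linear extension of `stackClass`. -/
noncomputable def stackMap (u : Fin 4 → List Letter) (π : Equiv.Perm (Fin 3)) :
    StackAlgebra 𝕜 →ₗ[𝕜] ASpace 𝕜 :=
  Finsupp.linearCombination 𝕜 (fun p : FreeMonoid (Fin 3 × Fin 3) => stackClass 𝕜 u π p.toList) ∘ₗ
    (MonoidAlgebra.coeffLinearEquiv 𝕜).toLinearMap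

theorem stackMap_of (u : Fin 4 → List Letter) (π : Equiv.Perm (Fin 3))
    (p : FreeMonoid (Fin 3 × Fin 3)) :
    stackMap 𝕜 u π (MonoidAlgebra.of 𝕜 _ p) = stackClass 𝕜 u π p.toList := by
  simp [stackMap]

/-- Two elements of an algebra are congruent if a given linear map cannot distinguish them, even
after multiplication on both sides. This is the coarsest ring congruence through which the linear
map factors. -/
def syntacticCon {A V : Type*} [Ring A] [Algebra 𝕜 A] [AddCommGroup V] [Module 𝕜 V]
    (φ : A →ₗ[𝕜] V) : RingCon A where
  r a b := ∀ p q, φ (p * a * q) = φ (p * b * q)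
  iseqv := ⟨fun _ _ _ => rfl, fun h p q => (h p q).symm, fun h h' p q => (h p q).trans (h' p q)⟩
  mul' {a b c d} h h' p q := by
    have h₁ := h p (c * q)
    have h₂ := h' (p * b) q
    simp only [← mul_assoc] at h₁ h₂ ⊢
    rw [h₁, h₂]
  add' {a b c d} h h' p q := by
    simp only [mul_add, add_mul, map_add, h p q, h' p q]

theorem apply_eq_of_syntacticCon {A V : Type*} [Ring A] [Algebra 𝕜 A] [AddCommGroup V]
    [Module 𝕜 V] {φ : A →ₗ[𝕜] V} {a b : A} (h : syntacticCon 𝕜 φ a b) : φ a = φ b := by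
  simpa using h 1 1

/-- The algebra of arrows on three strands placed along a line, modulo the relations that hold
between the classes of arrow diagrams. -/
abbrev StrandAlgebra (u : Fin 4 → List Letter) (π : Equiv.Perm (Fin 3)) : Type _ :=
  (syntacticCon 𝕜 (stackMap 𝕜 u π)).Quotient

/-- An elementary arrow between two of three strands placed along a line. -/
noncomputable def strandArrow (u : Fin 4 → List Letter) (π : Equiv.Perm (Fin 3))
    (c : Fin 3 × Fin 3) : StrandAlgebra 𝕜 u π :=
  (syntacticCon 𝕜 (stackMap 𝕜 u π)).mkₐ 𝕜 (stackArrow 𝕜 c)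

theorem stackMap_mul_mul_eq_zero {u : Fin 4 → List Letter} {π : Equiv.Perm (Fin 3)}
    {r : StackAlgebra 𝕜}
    (h : ∀ a b : FreeMonoid (Fin 3 × Fin 3),
      stackMap 𝕜 u π (MonoidAlgebra.of 𝕜 _ a * r * MonoidAlgebra.of 𝕜 _ b) = 0)
    (p q : StackAlgebra 𝕜) : stackMap 𝕜 u π (p * r * q) = 0 := by
  induction p using MonoidAlgebra.induction_on with
  | of a =>
    induction q using MonoidAlgebra.induction_on with
    | of b => exact h a b
    | add f g hf hg => rw [mul_add, map_add, hf, hg, add_zero]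
    | smul c f hf => rw [mul_smul_comm, map_smul, hf, smul_zero]
  | add f g hf hg => rw [add_mul, add_mul, map_add, hf, hg, add_zero]
  | smul c f hf => rw [smul_mul_assoc, smul_mul_assoc, map_smul, hf, smul_zero]

theorem strandArrow_commute_tails (u : Fin 4 → List Letter) (π : Equiv.Perm (Fin 3)) :
    Commute (strandArrow 𝕜 u π (0, 1)) (strandArrow 𝕜 u π (0, 2)) := by
  simp only [strandArrow]
  rw [Commute, SemiconjBy, ← map_mul, ← map_mul]
  refine (RingCon.eq _).2 fun p q => ?_
  rw [← sub_eq_zero, ← map_sub, ← sub_mul, ← mul_sub]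
  refine stackMap_mul_mul_eq_zero 𝕜 (fun a b => ?_) p q
  simp only [stackArrow, ← map_mul, mul_sub, sub_mul, map_sub, stackMap_of]
  rw [sub_eq_zero]
  simpa using stackClass_tc 𝕜 u π a.toList b.toList

theorem strandArrow_commute_fourT (u : Fin 4 → List Letter) (π : Equiv.Perm (Fin 3)) :
    Commute (strandArrow 𝕜 u π (0, 1) + strandArrow 𝕜 u π (0, 2)) (strandArrow 𝕜 u π (1, 2)) := by
  simp only [strandArrow]
  rw [Commute, SemiconjBy, ← map_add, ← map_mul, ← map_mul]
  refine (RingCon.eq _).2 fun p q => ?_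
  rw [← sub_eq_zero, ← map_sub, ← sub_mul, ← mul_sub]
  refine stackMap_mul_mul_eq_zero 𝕜 (fun a b => ?_) p q
  have h := stackClass_fourT 𝕜 u π a.toList b.toList
  rw [sub_add_sub_comm] at h
  simp only [stackArrow, mul_sub, sub_mul, mul_add, add_mul, ← map_mul, map_sub, map_add,
    stackMap_of]
  simpa using h

end

/-! ### Reservoirs on stacked arrows -/

/-- The word obtained by replacing each arrow `i` by `n i` parallel ones, as in
`ArrowWord.cable`. -/
def cableWord (n : ℕ → ℕ) (w : List Letter) : List Letter :=
  w.flatMap fun l => (List.range (n l.1)).map fun j => (Nat.pair l.1 j, l.2)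

theorem cable_word (D : ArrowWord) (n : ℕ → ℕ) : (D.cable n).word = cableWord n D.word := rfl

theorem cableWord_append (n : ℕ → ℕ) (v w : List Letter) :
    cableWord n (v ++ w) = cableWord n v ++ cableWord n w := by
  simp [cableWord]

theorem cableWord_place (n : ℕ → ℕ) (u : Fin 4 → List Letter) (π : Equiv.Perm (Fin 3))
    (c : Fin 3 → List Letter) :
    cableWord n (place u π c) =
      place (fun k => cableWord n (u k)) π fun s => cableWord n (c s) := by
  simp [place, cableWord_append]

theorem cableWord_congr {n n' : ℕ → ℕ} {w : List Letter} (h : ∀ l ∈ w, n l.1 = n' l.1) :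
    cableWord n w = cableWord n' w :=
  List.flatMap_congr fun l hl => by rw [h l hl]

theorem exists_of_mem_cableWord {n : ℕ → ℕ} {w : List Letter} {l : Letter} (h : l ∈ cableWord n w) :
    ∃ l' ∈ w, ∃ j < n l'.1, l = (Nat.pair l'.1 j, l'.2) := by
  simp only [cableWord, List.mem_flatMap, List.mem_map, List.mem_range] at h
  obtain ⟨l', hl', j, hj, rfl⟩ := h
  exact ⟨l', hl', j, hj, rfl⟩

/-- The stacked arrows obtained by replacing each arrow `i` by `n i` parallel ones. -/
def cableStack (n : ℕ → ℕ) (q : List (ℕ × Fin 3 × Fin 3)) : List (ℕ × Fin 3 × Fin 3) :=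
  q.flatMap fun a => (List.range (n a.1)).map fun j => (Nat.pair a.1 j, a.2)

theorem cableStack_congr {n n' : ℕ → ℕ} {q : List (ℕ × Fin 3 × Fin 3)}
    (h : ∀ a ∈ q, n a.1 = n' a.1) : cableStack n q = cableStack n' q :=
  List.flatMap_congr fun a ha => by rw [h a ha]

theorem cableWord_stack (n : ℕ → ℕ) (s : Fin 3) : ∀ q : List (ℕ × Fin 3 × Fin 3),
    (∀ a ∈ q, a.2.1 ≠ a.2.2) → cableWord n (stack q s) = stack (cableStack n q) s
  | [], _ => rfl
  | a :: q, h => by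
    have h₁ : stack (a :: q) s = stack [a] s ++ stack q s := stack_append [a] q s
    have h₂ : cableStack n (a :: q) =
        ((List.range (n a.1)).map fun j => (Nat.pair a.1 j, a.2)) ++ cableStack n q := rfl
    rw [h₁, h₂, cableWord_append, stack_append,
      cableWord_stack n s q fun b hb => h b (List.mem_cons_of_mem _ hb)]
    congr 1
    have ha := h a List.mem_cons_self
    by_cases hs : a.2.1 = s
    · have ht : a.2.2 ≠ s := fun e => ha (hs.trans e.symm)
      simp [stack, cableWord, hs, ht, List.flatMap_map]
      exact List.map_eq_flatMap
    · by_cases ht : a.2.2 = s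
      · simp [stack, cableWord, hs, ht, List.flatMap_map]
        exact List.map_eq_flatMap
      · simp [stack, cableWord, hs, ht, List.flatMap_map]

theorem cableStack_nodup (n : ℕ → ℕ) {q : List (ℕ × Fin 3 × Fin 3)} (h : (q.map Prod.fst).Nodup) :
    ((cableStack n q).map Prod.fst).Nodup := by
  rw [cableStack, List.map_flatMap, List.nodup_flatMap]
  refine ⟨fun a _ => ?_, (List.pairwise_map.1 h).imp fun {a b} hab => ?_⟩
  · rw [List.map_map]
    exact List.nodup_range.map fun i j hij => by simpa using hij
  · intro i hi hj
    simp only [List.map_map, List.mem_map, Function.comp] at hi hj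
    obtain ⟨i', -, rfl⟩ := hi
    obtain ⟨j', -, h⟩ := hj
    exact hab (Nat.pair_eq_pair.1 h).1.symm

theorem fst_of_mem_cableStack {n : ℕ → ℕ} {q : List (ℕ × Fin 3 × Fin 3)} {i : ℕ}
    (h : i ∈ (cableStack n q).map Prod.fst) : i.unpair.1 ∈ q.map Prod.fst := by
  simp only [cableStack, List.mem_map, List.mem_flatMap] at h
  obtain ⟨_, ⟨a, ha, j, -, rfl⟩, rfl⟩ := h
  exact List.mem_map.2 ⟨a, ha, by simp⟩

/-- The arrows with an end in the given pieces of a line. -/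
def contextArrows (u : Fin 4 → List Letter) : Finset ℕ :=
  Finset.univ.biUnion fun k => ((u k).map Prod.fst).toFinset

theorem mem_contextArrows {u : Fin 4 → List Letter} {i : ℕ} :
    i ∈ contextArrows u ↔ ∃ k, ∃ l ∈ u k, l.1 = i := by
  simp [contextArrows]

theorem nodup_of_place_stack {u : Fin 4 → List Letter} {π : Equiv.Perm (Fin 3)}
    {q : List (ℕ × Fin 3 × Fin 3)} (h : (place u π (stack q)).Nodup) :
    (q.map Prod.fst).Nodup ∧ Disjoint (contextArrows u) (q.map Prod.fst).toFinset := by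
  rw [List.nodup_iff_count_le_one] at h
  have h' : ∀ l : Letter, ∑ k, (u k).count l + (q.map Prod.fst).count l.1 ≤ 1 := fun l => by
    rw [← sum_count_stack l.1 l.2, ← count_place u π]
    exact h l
  refine ⟨List.nodup_iff_count_le_one.2 fun i => ?_, Finset.disjoint_left.2 fun i hi hi' => ?_⟩
  · exact (Nat.le_add_left _ _).trans (h' (i, .tail))
  · obtain ⟨k, l, hl, rfl⟩ := mem_contextArrows.1 hi
    have h₁ : 0 < ∑ k, (u k).count l :=
      Finset.sum_pos_iff.2 ⟨k, Finset.mem_univ _, List.count_pos_iff.2 hl⟩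
    have h₂ := List.count_pos_iff.2 (List.mem_toFinset.1 hi')
    have := h' l
    omega

theorem arrows_place_stack {D : ArrowWord} {u : Fin 4 → List Letter} {π : Equiv.Perm (Fin 3)}
    {q : List (ℕ × Fin 3 × Fin 3)} (h : D.word = place u π (stack q)) :
    D.arrows = contextArrows u ∪ (q.map Prod.fst).toFinset := by
  ext i
  rw [ArrowWord.arrows, h, Finset.mem_union, mem_contextArrows, List.mem_toFinset,
    List.mem_toFinset, List.mem_map]
  constructor
  · rintro ⟨l, hl, rfl⟩
    rcases mem_place.1 hl with ⟨k, hl⟩ | ⟨s, hl⟩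
    · exact Or.inl ⟨k, l, hl, rfl⟩
    · exact Or.inr (fst_mem_of_mem_stack hl)
  · rintro (⟨k, l, hl, rfl⟩ | hi)
    · exact ⟨l, mem_place.2 (Or.inl ⟨k, hl⟩), rfl⟩
    · rw [← List.count_pos_iff, ← sum_count_stack i .tail, Finset.sum_pos_iff] at hi
      obtain ⟨s, -, hs⟩ := hi
      exact ⟨_, mem_place.2 (Or.inr ⟨s, List.count_pos_iff.1 hs⟩), rfl⟩

section

variable (𝕜 : Type*) [Field 𝕜]

theorem prod_stackArrow_pow (n : ℕ → ℕ) : ∀ q : List (ℕ × Fin 3 × Fin 3),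
    (q.map fun a => stackArrow 𝕜 a.2 ^ n a.1).prod =
      MonoidAlgebra.of 𝕜 _ (FreeMonoid.ofList ((cableStack n q).map Prod.snd))
  | [] => rfl
  | a :: q => by
    have h : (cableStack n (a :: q)).map Prod.snd =
        List.replicate (n a.1) a.2 ++ (cableStack n q).map Prod.snd := by
      simp [cableStack, Function.comp_def]
    rw [List.map_cons, List.prod_cons, prod_stackArrow_pow n q, h, FreeMonoid.ofList_append,
      map_mul, stackArrow, ← map_pow]
    congr 2
    generalize n a.1 = m
    induction m with
    | zero => rfl
    | succ m ih => rw [pow_succ', ih, List.replicate_succ, FreeMonoid.ofList_cons]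

theorem prod_map_smul {ι A : Type*} [Ring A] [Algebra 𝕜 A] (c : ι → 𝕜) (m : ι → A) :
    ∀ o : List ι, (o.map fun a => c a • m a).prod = (o.map c).prod • (o.map m).prod
  | [] => by simp
  | a :: o => by simp [prod_map_smul c m o, smul_smul, mul_comm]

theorem expSeries_smul {A : Type*} [Ring A] [Algebra 𝕜 A] (c : 𝕜) (b : A) :
    expSeries 𝕜 (c • b) = PowerSeries.mk fun n => (c ^ n / (n.factorial : 𝕜)) • b ^ n := by
  ext n
  rw [expSeries, PowerSeries.coeff_mk, PowerSeries.coeff_mk, smul_pow, smul_smul, div_eq_inv_mul]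

/-- A reservoir on stacked arrows is a product of exponentials in the algebra of the three strands:
the arrows of the rest of the line are replaced by parallel ones in all possible ways. -/
theorem reservoir_eq_of_stack {G : GaussDiagram} {u : Fin 4 → List Letter}
    {π : Equiv.Perm (Fin 3)} {o : List (ℕ × Fin 3 × Fin 3)} (ho : ∀ a ∈ o, a.2.1 ≠ a.2.2)
    (hG : G.word = place u π (stack o)) (k : ℕ) :
    reservoir 𝕜 G k = ∑ p ∈ Finset.HasAntidiagonal.antidiagonal k,
      ∑ g ∈ (contextArrows u).piAntidiag p.1,
        (∏ i ∈ contextArrows u, (((G.sign i : ℤ) : 𝕜) ^ g i / ((g i).factorial : 𝕜))) •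
          stackMap 𝕜 (fun k => cableWord g (u k)) π (PowerSeries.coeff p.2
            (o.map fun a => expSeries 𝕜 (((G.sign a.1 : ℤ) : 𝕜) • stackArrow 𝕜 a.2)).prod) := by
  obtain ⟨hn, hd⟩ := nodup_of_place_stack (hG ▸ G.nodup)
  rw [reservoir, arrows_place_stack hG, sum_piAntidiag_union hd]
  refine Finset.sum_congr rfl fun p _ => Finset.sum_congr rfl fun g hg => ?_
  simp only [expSeries_smul]
  rw [coeff_prod_mk Prod.fst (fun a n =>
    ((((G.sign a.1 : ℤ) : 𝕜) ^ n / (n.factorial : 𝕜)) • stackArrow 𝕜 a.2 ^ n)) o hn, map_sum,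
    Finset.smul_sum]
  refine Finset.sum_congr rfl fun h hh => ?_
  have hg' : ∀ i ∈ (o.map Prod.fst).toFinset, g i = 0 := fun i hi => by
    by_contra hc
    exact Finset.disjoint_left.1 hd ((Finset.mem_piAntidiag.1 hg).2 i hc) hi
  have hh' : ∀ i ∈ contextArrows u, h i = 0 := fun i hi => by
    by_contra hc
    exact Finset.disjoint_left.1 hd hi ((Finset.mem_piAntidiag.1 hh).2 i hc)
  rw [Finset.prod_union hd, prod_map_smul, map_smul, prod_stackArrow_pow, stackMap_of, mul_smul]
  congr 1
  · exact Finset.prod_congr rfl fun i hi => by simp [hh' i hi]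
  congr 1
  · rw [List.prod_toFinset _ hn, List.map_map]
    congr 1
    refine List.map_congr_left fun a ha => ?_
    have : g a.1 = 0 := hg' a.1 (List.mem_toFinset.2 (List.mem_map_of_mem ha))
    simp [this]
  · have e₁ : (fun k => cableWord (g + h) (u k)) = fun k => cableWord g (u k) :=
      funext fun k => cableWord_congr fun l hl => by
        simp [hh' l.1 (mem_contextArrows.2 ⟨k, l, hl, rfl⟩)]
    have e₂ : (fun s => cableWord (g + h) (stack o s)) = stack (cableStack h o) :=
      funext fun s => by
        rw [cableWord_stack _ _ _ ho]
        congr 1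
        refine cableStack_congr fun a ha => ?_
        simp [hg' a.1 (List.mem_toFinset.2 (List.mem_map_of_mem ha))]
    rw [← wordClass_word, cable_word, hG, cableWord_place, e₁, e₂,
      wordClass_place_stack 𝕜 (cableStack_nodup h hn)]
    · rfl
    · intro k l hl hl'
      obtain ⟨l', hl₁, j, -, rfl⟩ := exists_of_mem_cableWord hl
      have := fst_of_mem_cableStack hl'
      rw [Nat.unpair_pair] at this
      exact Finset.disjoint_left.1 hd (mem_contextArrows.2 ⟨k, l', hl₁, rfl⟩)
        (List.mem_toFinset.2 this)

/-- A move between stacked arrows preserves reservoirs if it preserves the product of exponentials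
in the algebra of the three strands. -/
theorem reservoir_congr_of_stack {G G' : GaussDiagram} (hs : G'.sign = G.sign)
    {u : Fin 4 → List Letter} {π : Equiv.Perm (Fin 3)} {o o' : List (ℕ × Fin 3 × Fin 3)}
    (ho : ∀ a ∈ o, a.2.1 ≠ a.2.2) (ho' : ∀ a ∈ o', a.2.1 ≠ a.2.2)
    (hG : G.word = place u π (stack o)) (hG' : G'.word = place u π (stack o'))
    (H : ∀ u',
      (o.map fun a => expSeries 𝕜 (((G.sign a.1 : ℤ) : 𝕜) • strandArrow 𝕜 u' π a.2)).prod =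
        (o'.map fun a => expSeries 𝕜 (((G.sign a.1 : ℤ) : 𝕜) • strandArrow 𝕜 u' π a.2)).prod)
    (k : ℕ) : reservoir 𝕜 G k = reservoir 𝕜 G' k := by
  rw [reservoir_eq_of_stack 𝕜 ho hG, reservoir_eq_of_stack 𝕜 ho' hG', hs]
  refine Finset.sum_congr rfl fun p _ => Finset.sum_congr rfl fun g _ => congrArg _ ?_
  apply apply_eq_of_syntacticCon 𝕜
  rw [← RingCon.eq]
  let f := (syntacticCon 𝕜 (stackMap 𝕜 (fun k => cableWord g (u k)) π)).mkₐ 𝕜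
  have hf : ∀ o : List (ℕ × Fin 3 × Fin 3), f (PowerSeries.coeff p.2
      (o.map fun a => expSeries 𝕜 (((G.sign a.1 : ℤ) : 𝕜) • stackArrow 𝕜 a.2)).prod) =
        PowerSeries.coeff p.2 (o.map fun a => expSeries 𝕜 (((G.sign a.1 : ℤ) : 𝕜) •
          strandArrow 𝕜 (fun k => cableWord g (u k)) π a.2)).prod := fun o => by
    change RingHomClass.toRingHom f _ = _
    rw [← PowerSeries.coeff_map, map_list_prod, List.map_map]
    refine congrArg (fun l => PowerSeries.coeff p.2 (List.prod l))
      (List.map_congr_left fun a _ => ?_)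
    simp [map_expSeries, strandArrow, f]
  exact (hf o).trans ((congrArg _ (H _)).trans (hf o').symm)

end

/-! ### Invariance of reservoirs under the moves -/

section

variable (𝕜 : Type*) [Field 𝕜]

theorem arrows_eq_of_perm {D D' : ArrowWord} (h : D.word.Perm D'.word) : D.arrows = D'.arrows :=
  List.toFinset_eq_of_perm _ _ (h.map _)

theorem reservoir_congr {G G' : GaussDiagram} (hs : G'.sign = G.sign) (hp : G.word.Perm G'.word)
    (h : ∀ n, wordClass 𝕜 (cableWord n G.word) = wordClass 𝕜 (cableWord n G'.word)) (k : ℕ) :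
    reservoir 𝕜 G k = reservoir 𝕜 G' k := by
  rw [reservoir, reservoir, arrows_eq_of_perm hp, hs]
  refine Finset.sum_congr rfl fun n _ => ?_
  rw [← wordClass_word, ← wordClass_word, cable_word, cable_word, h]

theorem cableWord_single (n : ℕ → ℕ) (i : ℕ) (e : ArrowEnd) :
    cableWord n [(i, e)] = ((List.range (n i)).map (Nat.pair i)).map (·, e) := by
  simp [cableWord]

theorem reservoir_tc {G G' : GaussDiagram} (hs : G'.sign = G.sign) (u v : List Letter) (i j : ℕ)
    (hG : G.word = u ++ [(i, .tail), (j, .tail)] ++ v)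
    (hG' : G'.word = u ++ [(j, .tail), (i, .tail)] ++ v) (k : ℕ) :
    reservoir 𝕜 G k = reservoir 𝕜 G' k := by
  refine reservoir_congr 𝕜 hs ?_ (fun n => ?_) k
  · rw [hG, hG']
    exact ((List.Perm.swap _ _ _).append_left u).append_right v
  · have h : ∀ x y : ℕ, [(x, ArrowEnd.tail), (y, ArrowEnd.tail)] =
        [(x, ArrowEnd.tail)] ++ [(y, ArrowEnd.tail)] := fun _ _ => rfl
    rw [hG, hG', h, h]
    simp only [cableWord_append, cableWord_single, ← List.map_append]
    exact wordClass_perm_tails 𝕜 List.perm_append_comm _ _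

theorem reservoir_relabel {G G' : GaussDiagram} (f : Equiv.Perm ℕ) (hw : G'.word = rename f G.word)
    (hs : ∀ i ∈ G.arrows, G'.sign (f i) = G.sign i) (k : ℕ) :
    reservoir 𝕜 G k = reservoir 𝕜 G' k := by
  have ha : G'.arrows = G.arrows.image f := by
    ext i
    simp [ArrowWord.arrows, hw, rename]
  rw [reservoir, reservoir, ha]
  refine Finset.sum_equiv (Equiv.arrowCongr f (Equiv.refl ℕ)) (fun n => ?_) fun n _ => ?_
  · simp only [Finset.mem_piAntidiag, Finset.sum_image f.injective.injOn]
    refine and_congr (by simp) ⟨fun h i hi => ?_, fun h i hi => ?_⟩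
    · exact Finset.mem_image.2 ⟨f.symm i, h _ (by simpa using hi), by simp⟩
    · obtain ⟨j, hj, hij⟩ := Finset.mem_image.1 (h (f i) (by simpa using hi))
      exact f.injective hij ▸ hj
  · rw [Finset.prod_image f.injective.injOn]
    congr 1
    · exact Finset.prod_congr rfl fun i hi => by simp [hs i hi]
    · rw [← wordClass_word, ← wordClass_word, cable_word, cable_word, hw]
      have : cableWord (Equiv.arrowCongr f (Equiv.refl ℕ) n) (rename f G.word) =
          mapNames (fun m => Nat.pair (f m.unpair.1) m.unpair.2) (cableWord n G.word) := by
        simp [cableWord, rename, mapNames, List.flatMap_map, List.map_flatMap, Function.comp_def]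
      rw [this, wordClass_mapNames]
      intro a _ b _ hab
      simp only [Nat.pair_eq_pair, EmbeddingLike.apply_eq_iff_eq] at hab
      rw [← Nat.pair_unpair a, ← Nat.pair_unpair b, hab.1, hab.2]

/-- An isolated arrow can be moved across the head of another arrow. This is the 4T relation in
which the strands `1` and `2`, adjacent on the line, carry the ends of the isolated arrow and the
strand `0` carries the tail of the other arrow: two of the four terms then cancel. -/
theorem wordClass_isolated_head (A B : List Letter) (a b : ℕ) :
    wordClass 𝕜 (A ++ [(b, .head), (a, .tail), (a, .head)] ++ B) =
      wordClass 𝕜 (A ++ [(a, .tail), (a, .head), (b, .head)] ++ B) := by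
  have hp : (A ++ [(b, ArrowEnd.head), (a, ArrowEnd.tail), (a, ArrowEnd.head)] ++ B).Perm
      (A ++ [(a, ArrowEnd.tail), (a, ArrowEnd.head), (b, ArrowEnd.head)] ++ B) :=
    List.Perm.append_right _ (List.Perm.append_left _
      (List.perm_append_comm (l₁ := [(b, ArrowEnd.head)])))
  by_cases h : Valid (A ++ [(b, ArrowEnd.head), (a, ArrowEnd.tail), (a, ArrowEnd.head)] ++ B)
  swap
  · rw [wordClass_of_not_valid 𝕜 h, wordClass_of_not_valid 𝕜 (mt (valid_perm_iff hp).2 h)]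
  have hba : b ≠ a := by
    rintro rfl
    have := List.nodup_iff_count_le_one.1 h.1 (b, .head)
    simp [List.count_append] at this
    omega
  have hb : (b, ArrowEnd.tail) ∈ A ∨ (b, ArrowEnd.tail) ∈ B := by
    have := (h.2 b).2 (by simp)
    simpa [hba] using this
  -- The strand `0` comes before the other two or after them, depending on where that tail lies.
  rcases hb with hb | hb
  · obtain ⟨A₁, A₂, rfl⟩ := List.append_of_mem hb
    have := wordClass_fourT 𝕜 ![A₁, A₂, [], B] 1 b a
    simp [place, stack] at this
    rw [← sub_eq_zero]
    simpa [sub_eq_add_neg] using this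
  · obtain ⟨B₁, B₂, rfl⟩ := List.append_of_mem hb
    have := wordClass_fourT 𝕜 ![A, [], B₁, B₂] (finRotate 3) b a
    have e0 : finRotate 3 0 = 1 := rfl
    have e1 : finRotate 3 1 = 2 := rfl
    have e2 : finRotate 3 2 = 0 := rfl
    simp [place, stack, e0, e1, e2] at this
    rw [← sub_eq_zero]
    simpa [sub_eq_add_neg] using this

theorem wordClass_isolated_heads (A B : List Letter) (a : ℕ) (l : List ℕ) :
    wordClass 𝕜 (A ++ l.map (·, ArrowEnd.head) ++ [(a, .tail), (a, .head)] ++ B) =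
      wordClass 𝕜 (A ++ [(a, .tail), (a, .head)] ++ l.map (·, ArrowEnd.head) ++ B) := by
  induction l generalizing A with
  | nil => simp
  | cons b l ih =>
    have h₁ := ih (A ++ [(b, .head)])
    have h₂ := wordClass_isolated_head 𝕜 A (l.map (·, ArrowEnd.head) ++ B) a b
    simp only [List.append_assoc, List.map_cons, List.cons_append, List.nil_append] at h₁ h₂ ⊢
    rw [h₁, h₂]

/-- Parallel copies of an isolated arrow pointing right can be made into isolated arrows. -/
theorem wordClass_tails_heads (A B : List Letter) (l : List ℕ) :
    wordClass 𝕜 (A ++ l.map (·, ArrowEnd.tail) ++ l.map (·, ArrowEnd.head) ++ B) =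
      wordClass 𝕜 (A ++ l.reverse.flatMap (fun a => [(a, .tail), (a, .head)]) ++ B) := by
  induction l generalizing B with
  | nil => simp
  | cons a l ih =>
    -- With the tail of `a` last, `a` is isolated and can be moved out to the right.
    have h₁ := wordClass_perm_tails 𝕜 (List.perm_append_comm (l₁ := [a]) (l₂ := l)) A
      ((a, .head) :: l.map (·, ArrowEnd.head) ++ B)
    have h₂ := wordClass_isolated_heads 𝕜 (A ++ l.map (·, ArrowEnd.tail)) B a l
    have h₃ := ih ([(a, .tail), (a, .head)] ++ B)
    simp only [List.append_assoc, List.map_cons, List.map_append, List.map_nil, List.cons_append,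
      List.nil_append, List.reverse_cons, List.flatMap_append, List.flatMap_cons,
      List.flatMap_nil] at h₁ h₂ h₃ ⊢
    rw [h₁, ← h₂, h₃]

/-- Parallel copies of an isolated arrow pointing left can be made into isolated arrows, which can
be reversed. -/
theorem wordClass_heads_tails (A B : List Letter) (l : List ℕ) :
    wordClass 𝕜 (A ++ l.map (·, ArrowEnd.head) ++ l.map (·, ArrowEnd.tail) ++ B) =
      wordClass 𝕜 (A ++ l.reverse.flatMap (fun a => [(a, .tail), (a, .head)]) ++ B) := by
  induction l using List.reverseRecOn generalizing A with
  | nil => simp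
  | append_singleton l a ih =>
    -- With the tail of `a` first, `a` is isolated and can be moved out to the left.
    have h₁ := wordClass_perm_tails 𝕜 (List.perm_append_comm (l₁ := l) (l₂ := [a]))
      (A ++ l.map (·, ArrowEnd.head) ++ [(a, .head)]) B
    have h₂ := wordClass_ri 𝕜 (A ++ l.map (·, ArrowEnd.head)) (l.map (·, ArrowEnd.tail) ++ B) a
    have h₃ := wordClass_isolated_heads 𝕜 A (l.map (·, ArrowEnd.tail) ++ B) a l
    have h₄ := ih (A ++ [(a, .tail), (a, .head)])
    simp only [List.append_assoc, List.map_cons, List.map_append, List.map_nil, List.cons_append,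
      List.nil_append, List.reverse_append, List.reverse_cons, List.reverse_nil,
      List.flatMap_cons] at h₁ h₂ h₃ h₄ ⊢
    rw [h₁, ← h₂, h₃, h₄]

theorem reservoir_r1s {G G' : GaussDiagram} (hs : G'.sign = G.sign) (u v : List Letter) (i : ℕ)
    (hG : G.word = u ++ [(i, .tail), (i, .head)] ++ v)
    (hG' : G'.word = u ++ [(i, .head), (i, .tail)] ++ v) (k : ℕ) :
    reservoir 𝕜 G k = reservoir 𝕜 G' k := by
  refine reservoir_congr 𝕜 hs ?_ (fun n => ?_) k
  · rw [hG, hG']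
    exact ((List.Perm.swap _ _ _).append_left u).append_right v
  · have h : ∀ e e' : ArrowEnd, [(i, e), (i, e')] = [(i, e)] ++ [(i, e')] := fun _ _ => rfl
    rw [hG, hG', h, h]
    simp only [cableWord_append, cableWord_single, ← List.append_assoc]
    rw [wordClass_tails_heads, wordClass_heads_tails]

/-- Since tails commute, a diagram on three strands which differs from stacked arrows at most by
the order of two tails on the strand `0` has the reservoirs of the stacked arrows. -/
theorem exists_reservoir_eq_stack (G : GaussDiagram) {u : Fin 4 → List Letter}
    {π : Equiv.Perm (Fin 3)} {c : Fin 3 → List Letter} (hG : G.word = place u π c)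
    (o : List (ℕ × Fin 3 × Fin 3)) (x y : ℕ)
    (h₀ : c 0 = stack o 0 ∨
      c 0 = [(x, .tail), (y, .tail)] ∧ stack o 0 = [(y, .tail), (x, .tail)])
    (h₁ : c 1 = stack o 1) (h₂ : c 2 = stack o 2) :
    ∃ G₁ : GaussDiagram, G₁.sign = G.sign ∧ G₁.word = place u π (stack o) ∧
      ∀ k, reservoir 𝕜 G k = reservoir 𝕜 G₁ k := by
  rcases h₀ with h₀ | ⟨h₀, h₀'⟩
  · have : c = stack o := funext fun s => by fin_cases s <;> assumption
    exact ⟨G, rfl, this ▸ hG, fun _ => rfl⟩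
  · obtain ⟨A, B, h⟩ := exists_place_update u π c 0
    have hc : place u π c = A ++ [(x, .tail), (y, .tail)] ++ B := by
      rw [← h, ← h₀, Function.update_eq_self]
    have ho : place u π (stack o) = A ++ [(y, .tail), (x, .tail)] ++ B := by
      rw [← h, ← h₀']
      congr 1
      funext s
      fin_cases s
      · simp
      · simpa using h₁.symm
      · simpa using h₂.symm
    have hv : Valid (place u π (stack o)) := by
      refine (hG ▸ G.valid : Valid (place u π c)).perm ?_
      rw [hc, ho]
      exact ((List.Perm.swap _ _ _).append_left A).append_right B
    exact ⟨⟨⟨_, hv.1, hv.2⟩, G.sign⟩, rfl, rfl, fun k =>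
      reservoir_tc 𝕜 (G := G) (G' := ⟨⟨_, hv.1, hv.2⟩, G.sign⟩) rfl A B x y (hG.trans hc) ho k⟩

variable [CharZero 𝕜]

/-- Second Reidemeister moves: the reservoirs on two parallel arrows of opposite signs cancel. -/
theorem reservoir_r2_stack {G G' : GaussDiagram} (hs : G'.sign = G.sign) {u : Fin 4 → List Letter}
    {π : Equiv.Perm (Fin 3)} {c : Fin 3 → List Letter} {i j : ℕ} (hij : G.sign j = -G.sign i)
    (hG : G.word = place u π c) (h₀ : c 0 = [(i, .tail), (j, .tail)])
    (h₁ : c 1 = [(i, .head), (j, .head)] ∨ c 1 = [(j, .head), (i, .head)]) (h₂ : c 2 = [])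
    (hG' : G'.word = place u π (stack [])) (k : ℕ) :
    reservoir 𝕜 G k = reservoir 𝕜 G' k := by
  rcases h₁ with h₁ | h₁
  · obtain ⟨G₁, hs₁, hG₁, e⟩ := exists_reservoir_eq_stack 𝕜 G hG [(i, 0, 1), (j, 0, 1)] i j
      (by simp [h₀, stack]) (by simp [h₁, stack]) (by simp [h₂, stack])
    rw [e]
    refine reservoir_congr_of_stack 𝕜 (hs.trans hs₁.symm) (by simp) (by simp) hG₁ hG' ?_ k
    intro u'
    simp [hs₁, hij, expSeries_mul_neg]
  · obtain ⟨G₁, hs₁, hG₁, e⟩ := exists_reservoir_eq_stack 𝕜 G hG [(j, 0, 1), (i, 0, 1)] i j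
      (by simp [h₀, stack]) (by simp [h₁, stack]) (by simp [h₂, stack])
    rw [e]
    refine reservoir_congr_of_stack 𝕜 (hs.trans hs₁.symm) (by simp) (by simp) hG₁ hG' ?_ k
    intro u'
    simp [hs₁, hij, expSeries_neg_mul]

/-- The order in which the arrows of one side of a third Reidemeister move are stacked. It is the
one that induces the orders of the arrow ends on the middle and bottom strands in `r3Side`. -/
def r3Order (x y z : ℕ) (εx εy : ℤˣ) : List (ℕ × Fin 3 × Fin 3) :=
  if εx = 1 then
    if εy = 1 then [(x, 0, 1), (y, 0, 2), (z, 1, 2)] else [(y, 0, 2), (z, 1, 2), (x, 0, 1)]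
  else
    if εy = 1 then [(x, 0, 1), (z, 1, 2), (y, 0, 2)] else [(z, 1, 2), (y, 0, 2), (x, 0, 1)]

/-- Third Reidemeister moves: the exponentials of the three arrows satisfy the Yang–Baxter
equation, for all signs. -/
theorem reservoir_r3 {G G' : GaussDiagram} (hs : G'.sign = G.sign) (u : Fin 4 → List Letter)
    (π : Equiv.Perm (Fin 3)) (x y z : ℕ)
    (hG : G.word = place u π (r3Side x y z (G.sign x) (G.sign y) (G.sign z)))
    (hG' : G'.word = place u π fun s => (r3Side x y z (G.sign x) (G.sign y) (G.sign z) s).reverse)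
    (k : ℕ) : reservoir 𝕜 G k = reservoir 𝕜 G' k := by
  obtain ⟨G₁, hs₁, hG₁, e⟩ : ∃ G₁ : GaussDiagram, G₁.sign = G.sign ∧
      G₁.word = place u π (stack (r3Order x y z (G.sign x) (G.sign y))) ∧
      ∀ k, reservoir 𝕜 G k = reservoir 𝕜 G₁ k := by
    rcases Int.units_eq_one_or (G.sign z) with hz | hz
    · refine exists_reservoir_eq_stack 𝕜 G hG _ x y ?_ ?_ ?_ <;>
      rcases Int.units_eq_one_or (G.sign x) with hx | hx <;>
      rcases Int.units_eq_one_or (G.sign y) with hy | hy <;>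
      simp [hx, hy, hz, r3Side, r3Order, stack, inOrder]
    · refine exists_reservoir_eq_stack 𝕜 G hG _ y x ?_ ?_ ?_ <;>
      rcases Int.units_eq_one_or (G.sign x) with hx | hx <;>
      rcases Int.units_eq_one_or (G.sign y) with hy | hy <;>
      simp [hx, hy, hz, r3Side, r3Order, stack, inOrder]
  obtain ⟨G₂, hs₂, hG₂, e'⟩ : ∃ G₂ : GaussDiagram, G₂.sign = G'.sign ∧
      G₂.word = place u π (stack (r3Order x y z (G.sign x) (G.sign y)).reverse) ∧
      ∀ k, reservoir 𝕜 G' k = reservoir 𝕜 G₂ k := by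
    rcases Int.units_eq_one_or (G.sign z) with hz | hz
    · refine exists_reservoir_eq_stack 𝕜 G' hG' _ y x ?_ ?_ ?_ <;>
      rcases Int.units_eq_one_or (G.sign x) with hx | hx <;>
      rcases Int.units_eq_one_or (G.sign y) with hy | hy <;>
      simp [hx, hy, hz, r3Side, r3Order, stack, inOrder]
    · refine exists_reservoir_eq_stack 𝕜 G' hG' _ x y ?_ ?_ ?_ <;>
      rcases Int.units_eq_one_or (G.sign x) with hx | hx <;>
      rcases Int.units_eq_one_or (G.sign y) with hy | hy <;>
      simp [hx, hy, hz, r3Side, r3Order, stack, inOrder]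
  have ho : ∀ a ∈ r3Order x y z (G.sign x) (G.sign y), a.2.1 ≠ a.2.2 := by
    unfold r3Order
    split_ifs <;> simp
  rw [e, e']
  refine reservoir_congr_of_stack 𝕜 (hs₂.trans (hs.trans hs₁.symm)) ho
    (fun a ha => ho a (List.mem_reverse.1 ha)) hG₁ hG₂ (fun u' => ?_) k
  have hxy := strandArrow_commute_tails 𝕜 u' π
  have h4 := (strandArrow_commute_fourT 𝕜 u' π).smul_right ((G.sign z : ℤ) : 𝕜)
  rw [hs₁]
  rcases Int.units_eq_one_or (G.sign x) with hx | hx <;>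
    rcases Int.units_eq_one_or (G.sign y) with hy | hy
  · have := expSeries_yangBaxter 𝕜 hxy h4
    simpa [r3Order, hx, hy, ← mul_assoc] using this
  · have := expSeries_yangBaxter_neg 𝕜 hxy h4
    simpa [r3Order, hx, hy, ← mul_assoc] using this
  · have := expSeries_yangBaxter_neg 𝕜 hxy.symm (add_comm (strandArrow 𝕜 u' π (0, 1)) _ ▸ h4)
    simpa [r3Order, hx, hy, ← mul_assoc] using this
  · have := expSeries_yangBaxter 𝕜 (hxy.neg_left.neg_right)
      (neg_add (strandArrow 𝕜 u' π (0, 1)) _ ▸ h4.neg_left)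
    simpa [r3Order, hx, hy, ← mul_assoc] using this.symm

theorem reservoir_eq_of_wMove {G G' : GaussDiagram} (h : WMove G G') (k : ℕ) :
    reservoir 𝕜 G k = reservoir 𝕜 G' k := by
  cases h with
  | relabel f hw hs => exact reservoir_relabel 𝕜 f hw hs k
  | r1s hs u v i hG hG' => exact reservoir_r1s 𝕜 hs u v i hG hG' k
  | r2 hs u v w h i j hij hh hG hG' =>
    exact reservoir_r2_stack 𝕜 hs (u := ![u, v, w, []]) (π := 1)
      (c := ![[(i, .tail), (j, .tail)], h, []]) hij (by simp [place, hG]) rfl hh rfl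
      (by simp [place, stack, hG']) k
  | r2' hs u v w h i j hij hh hG hG' =>
    exact reservoir_r2_stack 𝕜 hs (u := ![u, v, w, []]) (π := Equiv.swap 0 1)
      (c := ![[(i, .tail), (j, .tail)], h, []]) hij
      (by simp [place, hG, Equiv.swap_apply_of_ne_of_ne]) rfl hh rfl (by simp [place, stack, hG']) k
  | r3 hs u π x y z hG hG' => exact reservoir_r3 𝕜 hs u π x y z hG hG' k
  | oc hs u v i j hG hG' => exact reservoir_tc 𝕜 hs u v i j hG hG' k

end

/-! ### The expansion -/

theorem mem_arrows {D : ArrowWord} {i : ℕ} : i ∈ D.arrows ↔ ∃ e, (i, e) ∈ D.word := by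
  simp [ArrowWord.arrows]

theorem arrows_erase (D : ArrowWord) (T : Finset ℕ) : (D.erase T).arrows = D.arrows \ T := by
  ext i
  simp [mem_arrows, ArrowWord.erase]

theorem card_arrows_cable (D : ArrowWord) (n : ℕ → ℕ) :
    (D.cable n).arrows.card = ∑ i ∈ D.arrows, n i := by
  have : (D.cable n).arrows =
      D.arrows.biUnion fun i => (Finset.range (n i)).image (Nat.pair i) := by
    ext m
    simp only [mem_arrows, cable_word, cableWord, List.mem_flatMap, List.mem_map, List.mem_range,
      Finset.mem_biUnion, Finset.mem_image, Finset.mem_range, Prod.exists, Prod.mk.injEq]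
    constructor
    · rintro ⟨e, i, e', h, j, hj, rfl, rfl⟩
      exact ⟨i, ⟨_, h⟩, j, hj, rfl⟩
    · rintro ⟨i, ⟨e, h⟩, j, hj, rfl⟩
      exact ⟨e, i, e, h, j, hj, rfl, rfl⟩
  rw [this, Finset.card_biUnion]
  · refine Finset.sum_congr rfl fun i _ => ?_
    rw [Finset.card_image_of_injective, Finset.card_range]
    exact fun a b h => (Nat.pair_eq_pair.1 h).2
  · intro i _ j _ hij
    rw [Function.onFun, Finset.disjoint_left]
    intro m hm hm'
    obtain ⟨a, -, rfl⟩ := Finset.mem_image.1 hm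
    obtain ⟨b, -, h⟩ := Finset.mem_image.1 hm'
    exact hij (Nat.pair_eq_pair.1 h).1.symm

theorem cableWord_erase (D : ArrowWord) (T : Finset ℕ) {n : ℕ → ℕ} (h : ∀ i ∈ T, n i = 0) :
    cableWord n (D.erase T).word = cableWord n D.word := by
  simp only [ArrowWord.erase]
  induction D.word with
  | nil => rfl
  | cons l w ih =>
    by_cases hl : l.1 ∈ T
    · simpa [cableWord, hl, h l.1 hl] using ih
    · simpa [cableWord, hl] using ih

theorem map_extend {M N : Type*} [AddCommGroup M] [AddCommGroup N] (f : M →+ N)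
    (V : LongWKnot → M) (G : GaussDiagram) (S : Finset ℕ) :
    f (extend V G S) = extend (fun K => f (V K)) G S := by
  simp [extend]

/-- The signed sum over the resolutions of the semi-virtual crossings for which the arrows in `T`
do not occur. -/
theorem sum_prod_resolutionSign (S : Finset ℕ) (ε : ℕ → ℤˣ) (n : ℕ → ℕ) :
    ∑ T ∈ S.powerset, (if ∀ i ∈ T, n i = 0 then ∏ i ∈ S, resolutionSign (ε i) (i ∈ T) else 0) =
      ∏ i ∈ S, if n i = 0 then 0 else (ε i : ℤ) := by
  have h := Finset.prod_add (fun i => if n i = 0 then -(ε i : ℤ) else 0) (fun i => (ε i : ℤ)) S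
  have h' : ∀ i, (if n i = 0 then -(ε i : ℤ) else 0) + (ε i : ℤ) =
      if n i = 0 then 0 else (ε i : ℤ) := fun i => by split_ifs <;> simp
  simp only [h'] at h
  rw [h]
  refine Finset.sum_congr rfl fun T hT => ?_
  rw [Finset.mem_powerset] at hT
  split_ifs with hn
  · rw [← Finset.prod_sdiff hT, mul_comm]
    congr 1
    · exact Finset.prod_congr rfl fun i hi => by simp [resolutionSign, hi, hn i hi]
    · exact Finset.prod_congr rfl fun i hi => by
        simp [resolutionSign, (Finset.mem_sdiff.1 hi).2]
  · push Not at hn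
    obtain ⟨i, hi, hni⟩ := hn
    rw [Finset.prod_eq_zero hi (by simp [hni]), zero_mul]

section

variable (𝕜 : Type*) [Field 𝕜]

theorem reservoir_mem_degreePart (G : GaussDiagram) (k : ℕ) :
    reservoir 𝕜 G k ∈ degreePart 𝕜 k := by
  refine Submodule.sum_mem _ fun n hn => Submodule.smul_mem _ _ (Submodule.subset_span ?_)
  exact ⟨_, by rw [card_arrows_cable]; exact (Finset.mem_piAntidiag.1 hn).1, rfl⟩

theorem reservoir_erase (G : GaussDiagram) (T : Finset ℕ) (k : ℕ) :
    reservoir 𝕜 (G.erase T) k = ∑ n ∈ G.arrows.piAntidiag k, if ∀ i ∈ T, n i = 0 then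
      (∏ i ∈ G.arrows, (((G.sign i : ℤ) : 𝕜) ^ n i / ((n i).factorial : 𝕜))) •
        diagramClass 𝕜 (G.toArrowWord.cable n) else 0 := by
  have ha : (G.erase T).arrows = G.arrows \ T := arrows_erase _ _
  rw [reservoir, ha, ← Finset.sum_filter]
  refine Finset.sum_congr ?_ fun n hn => ?_
  · ext n
    simp only [Finset.mem_filter, Finset.mem_piAntidiag, Finset.mem_sdiff]
    constructor
    · rintro ⟨h₁, h₂⟩
      have hT : ∀ i ∈ T, n i = 0 := fun i hi => by
        by_contra hc
        exact (h₂ i hc).2 hi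
      refine ⟨⟨?_, fun i hi => (h₂ i hi).1⟩, hT⟩
      rw [← h₁]
      exact (Finset.sum_subset Finset.sdiff_subset fun i _ hi' => by
        by_contra hc
        exact hi' (Finset.mem_sdiff.2 (h₂ i hc))).symm
    · rintro ⟨⟨h₁, h₂⟩, hT⟩
      refine ⟨?_, fun i hi => ⟨h₂ i hi, fun h => hi (hT i h)⟩⟩
      rw [← h₁]
      exact Finset.sum_subset Finset.sdiff_subset fun i hi hi' => hT i (by
        by_contra hc
        exact hi' (Finset.mem_sdiff.2 ⟨hi, hc⟩))
  · have hT := (Finset.mem_filter.1 hn).2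
    congr 1
    · refine Finset.prod_subset Finset.sdiff_subset fun i hi hi' => ?_
      have : n i = 0 := hT i (by
        by_contra hc
        exact hi' (Finset.mem_sdiff.2 ⟨hi, hc⟩))
      simp [this]
    · rw [← wordClass_word, ← wordClass_word, cable_word, cable_word]
      exact congrArg _ (cableWord_erase G.toArrowWord T hT)

/-- When semi-virtual crossings are resolved, only those reservoirs survive that have at least one
arrow at each semi-virtual crossing. -/
theorem sum_resolutionSign_smul_reservoir (G : GaussDiagram) (S : Finset ℕ) (k : ℕ) :
    ∑ T ∈ S.powerset, (∏ i ∈ S, resolutionSign (G.sign i) (i ∈ T)) • reservoir 𝕜 (G.erase T) k =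
      ∑ n ∈ G.arrows.piAntidiag k, (∏ i ∈ S, if n i = 0 then 0 else (G.sign i : ℤ)) •
        ((∏ i ∈ G.arrows, (((G.sign i : ℤ) : 𝕜) ^ n i / ((n i).factorial : 𝕜))) •
          diagramClass 𝕜 (G.toArrowWord.cable n)) := by
  simp only [reservoir_erase, Finset.smul_sum]
  rw [Finset.sum_comm]
  refine Finset.sum_congr rfl fun n _ => ?_
  rw [← sum_prod_resolutionSign, Finset.sum_smul]
  exact Finset.sum_congr rfl fun T _ => by split_ifs <;> simp

theorem diagramClass_cable_indicator (G : GaussDiagram) (S : Finset ℕ) :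
    diagramClass 𝕜 (G.toArrowWord.cable fun i => if i ∈ S then 1 else 0) =
      diagramClass 𝕜 (G.underlying S) := by
  have : (G.toArrowWord.cable fun i => if i ∈ S then 1 else 0).word =
      mapNames (Nat.pair · 0) (G.underlying S).word := by
    rw [cable_word, GaussDiagram.underlying, ← cableWord_erase _ (G.arrows \ S)
      (fun i hi => by simp [(Finset.mem_sdiff.1 hi).2])]
    have hS : ∀ l ∈ (G.toArrowWord.erase (G.arrows \ S)).word, l.1 ∈ S := by
      intro l hl
      have : l.1 ∈ (G.toArrowWord.erase (G.arrows \ S)).arrows := mem_arrows.2 ⟨l.2, hl⟩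
      rw [arrows_erase] at this
      by_contra hc
      have h := Finset.mem_sdiff.1 this
      exact h.2 (Finset.mem_sdiff.2 ⟨h.1, hc⟩)
    rw [mapNames, List.map_eq_flatMap]
    exact List.flatMap_congr fun l hl => by simp [hS l hl]
  rw [← wordClass_word, ← wordClass_word, this, wordClass_mapNames]
  exact fun a _ b _ h => (Nat.pair_eq_pair.1 h).1

theorem sum_resolutionSign_smul_reservoir_of_lt (G : GaussDiagram) {S : Finset ℕ}
    (hS : S ⊆ G.arrows) {k : ℕ} (hk : k < S.card) :
    ∑ T ∈ S.powerset, (∏ i ∈ S, resolutionSign (G.sign i) (i ∈ T)) • reservoir 𝕜 (G.erase T) k =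
      0 := by
  rw [sum_resolutionSign_smul_reservoir]
  refine Finset.sum_eq_zero fun n hn => ?_
  obtain ⟨i, hi, h0⟩ : ∃ i ∈ S, n i = 0 := by
    by_contra! hc
    have h₁ : S.card ≤ ∑ i ∈ S, n i := by
      simpa using Finset.sum_le_sum fun i hi => Nat.one_le_iff_ne_zero.2 (hc i hi)
    have h₂ : ∑ i ∈ S, n i ≤ ∑ i ∈ G.arrows, n i := Finset.sum_le_sum_of_subset hS
    have h₃ : ∑ i ∈ G.arrows, n i = k := (Finset.mem_piAntidiag.1 hn).1
    omega
  rw [Finset.prod_eq_zero hi (by simp [h0]), zero_smul]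

theorem sum_resolutionSign_smul_reservoir_card (G : GaussDiagram) {S : Finset ℕ}
    (hS : S ⊆ G.arrows) :
    ∑ T ∈ S.powerset, (∏ i ∈ S, resolutionSign (G.sign i) (i ∈ T)) •
        reservoir 𝕜 (G.erase T) S.card = diagramClass 𝕜 (G.underlying S) := by
  rw [sum_resolutionSign_smul_reservoir, ← diagramClass_cable_indicator]
  have hsum : ∑ i ∈ G.arrows, (if i ∈ S then 1 else 0) = S.card := by
    simp [Finset.inter_eq_right.2 hS]
  rw [Finset.sum_eq_single_of_mem (fun i => if i ∈ S then 1 else 0)]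
  · have h₁ : ∏ i ∈ S, (if (if i ∈ S then 1 else 0) = 0 then 0 else (G.sign i : ℤ)) =
        ∏ i ∈ S, (G.sign i : ℤ) := Finset.prod_congr rfl fun i hi => by simp [hi]
    have h₂ : ∏ i ∈ G.arrows, (((G.sign i : ℤ) : 𝕜) ^ (if i ∈ S then 1 else 0) /
        ((if i ∈ S then 1 else 0 : ℕ).factorial : 𝕜)) = ∏ i ∈ S, ((G.sign i : ℤ) : 𝕜) := by
      rw [← Finset.prod_subset hS fun i _ hi => by simp [hi]]
      exact Finset.prod_congr rfl fun i hi => by simp [hi]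
    rw [h₁, h₂, ← Int.cast_smul_eq_zsmul 𝕜, smul_smul, Int.cast_prod, ← Finset.prod_mul_distrib]
    have h₃ : ∀ i ∈ S, ((G.sign i : ℤ) : 𝕜) * ((G.sign i : ℤ) : 𝕜) = 1 := fun i _ => by
      rw [← Int.cast_mul, ← Units.val_mul, Int.units_mul_self]
      simp
    rw [Finset.prod_congr rfl h₃, Finset.prod_const_one, one_smul]
  · refine Finset.mem_piAntidiag.2 ⟨hsum, fun i hi => hS ?_⟩
    by_contra hc
    simp [hc] at hi
  · intro n hn hne
    obtain ⟨i, hi, h0⟩ : ∃ i ∈ S, n i = 0 := by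
      by_contra! hc
      apply hne
      have hle : ∀ i ∈ G.arrows, (if i ∈ S then 1 else 0) ≤ n i := fun i _ => by
        split_ifs with h
        · exact Nat.one_le_iff_ne_zero.2 (hc i h)
        · exact Nat.zero_le _
      have heq := (Finset.sum_eq_sum_iff_of_le hle).1
        (hsum.trans (Finset.mem_piAntidiag.1 hn).1.symm)
      funext i
      by_cases hi : i ∈ G.arrows
      · exact (heq i hi).symm
      · have : i ∉ S := fun h => hi (hS h)
        simp only [this, if_false]
        by_contra h
        exact hi ((Finset.mem_piAntidiag.1 hn).2 i h)
    rw [Finset.prod_eq_zero hi (by simp [h0]), zero_smul]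

variable [CharZero 𝕜]

/-- The invariant that places a reservoir at each arrow of a Gauss diagram. -/
noncomputable def expansion : LongWKnot → CompletedASpace 𝕜 :=
  Quot.lift (fun G k => ⟨reservoir 𝕜 G k, reservoir_mem_degreePart 𝕜 G k⟩) fun _ _ h =>
    funext fun k => Subtype.ext (reservoir_eq_of_wMove 𝕜 h k)

theorem expansion_knot (G : GaussDiagram) (k : ℕ) :
    (expansion 𝕜 G.knot k : ASpace 𝕜) = reservoir 𝕜 G k := rfl

theorem extend_expansion (G : GaussDiagram) (S : Finset ℕ) (k : ℕ) :
    (extend (expansion 𝕜) G S k : ASpace 𝕜) =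
      ∑ T ∈ S.powerset,
        (∏ i ∈ S, resolutionSign (G.sign i) (i ∈ T)) • reservoir 𝕜 (G.erase T) k :=
  map_extend ((degreePart 𝕜 k).subtype.toAddMonoidHom.comp
    (Pi.evalAddMonoidHom (fun m => degreePart 𝕜 m) k)) (expansion 𝕜) G S

theorem isExpansion_expansion : IsExpansion 𝕜 (expansion 𝕜) := fun G S hS =>
  ⟨fun k hk => Subtype.ext ((extend_expansion 𝕜 G S k).trans
    (sum_resolutionSign_smul_reservoir_of_lt 𝕜 G hS hk)),
    (extend_expansion 𝕜 G S _).trans (sum_resolutionSign_smul_reservoir_card 𝕜 G hS)⟩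

theorem extend_apply_expansion (m : ℕ) (W : ASpace 𝕜 →ₗ[𝕜] 𝕜) (G : GaussDiagram) (S : Finset ℕ) :
    extend (fun K => W (expansion 𝕜 K m)) G S = W (extend (expansion 𝕜) G S m) :=
  (map_extend (W.toAddMonoidHom.comp ((degreePart 𝕜 m).subtype.toAddMonoidHom.comp
    (Pi.evalAddMonoidHom (fun m => degreePart 𝕜 m) m))) (expansion 𝕜) G S).symm

end

end WKnot

theorem mainTheorem2 (𝕜 : Type*) [Field 𝕜] [CharZero 𝕜] :
    ∃ Z : WKnot.LongWKnot → WKnot.CompletedASpace 𝕜,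
      -- `Z` is computed by placing a reservoir at each arrow of any Gauss diagram of the knot
      (∀ (G : WKnot.GaussDiagram) (k : ℕ),
        (Z G.knot k : WKnot.ASpace 𝕜) = WKnot.reservoir 𝕜 G k) ∧
      -- `Z` is an expansion
      WKnot.IsExpansion 𝕜 Z ∧
      -- every linear functional `W` on the degree `m` part integrates: it is the `m`-th
      -- derivative of an invariant of type `m`, namely of `W` applied to the degree `m` part of `Z`
      (∀ (m : ℕ) (W : WKnot.ASpace 𝕜 →ₗ[𝕜] 𝕜),
        WKnot.IsOfType m (fun K => W (Z K m)) ∧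
        ∀ (G : WKnot.GaussDiagram) (S : Finset ℕ), S ⊆ G.arrows → S.card = m →
          WKnot.extend (fun K => W (Z K m)) G S = W (WKnot.diagramClass 𝕜 (G.underlying S))) := by
  refine ⟨WKnot.expansion 𝕜, WKnot.expansion_knot 𝕜, WKnot.isExpansion_expansion 𝕜, fun m W =>
    ⟨fun G S hS hm => ?_, fun G S hS hm => ?_⟩⟩
  · rw [WKnot.extend_apply_expansion, ((WKnot.isExpansion_expansion 𝕜) G S hS).1 m hm]
    simp
  · subst hm
    rw [WKnot.extend_apply_expansion, ((WKnot.isExpansion_expansion 𝕜) G S hS).2]
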